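/- Let $A_n$ be the $n$th Weyl algebra over $\mathbb{C}$, generated by $a_1,\dots,a_n,a_1^\dagger,\dots,a_n^\dagger$ with $[a_i,a_j^\dagger]=\delta_{ij}$ and all other commutators of generators zero, and let $g\mapsto g^\dagger$ be its conjugate-linear anti-automorphism exchanging $a_j$ and $a_j^\dagger$. For $\gamma=(\alpha,\beta)\in\mathbb{Z}_{\ge0}^n\times\mathbb{Z}_{\ge0}^n$ let $a^\gamma=(a_1^\dagger)^{\alpha_1}\cdots(a_n^\dagger)^{\alpha_n}a_1^{\beta_1}\cdots a_n^{\beta_n}$ and $|\gamma|=\sum_j(\alpha_j+\beta_j)$. The $a^\gamma$ form a basis of $A_n$; $\deg(g)$ is the largest $|\gamma|$ such that $a^\gamma$ has a nonzero coefficient in $g$, and $\deg(0)=-\infty$. Put $g_+^\gamma=i\big((a^\gamma)^\dagger+a^\gamma\big)$ and $g_-^\gamma=(a^\gamma)^\dagger-a^\gamma$. With the lexicographic order on $\mathbb{Z}_{\ge0}^n$ (the smallest index at which two vectors differ decides), the $g_+^\gamma$ with $\alpha\ge\beta$ and the $g_-^\gamma$ with $\alpha>\beta$ form a basis of the real Lie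 algebra $\hat A_n=\{g\in A_n: g^\dagger=-g\}$. Let $\hat A_n^{\mathrm{core}}\subseteq\hat A_n$ be the sum of the real spans of the following sets: (0) $2i$ and the $2i\,a_k^\dagger a_k$, $1\le k\le n$; (1) the $g_\pm^\gamma$ with $|\gamma|=1$; (2) the $g_\pm^\gamma$ with $|\gamma|=2$ and $\alpha_k\ne\beta_k$ for exactly one or exactly two indices $k$; (=) the $g_\pm^\gamma$ with $\alpha=\beta$ and $|\gamma|\ge4$; (om) the $g_\pm^\gamma$ with $|\gamma|\ge3$ such that, for a unique index $k$, $\alpha_k+\beta_k=1$ and $\alpha_j=\beta_j$ for all $j\ne k$. Let $\hat A_n^\perp$ be the orthogonal complement of $\hat A_n^{\mathrm{core}}$ in $\hat A_n$ with respect to the scalar product $\langle v,w\rangle=\operatorname{Re}\sum_\gamma\overline{v_\gamma}\,w_\gamma$, where $v=\sum_\gamma v_\gamma a^\gamma$ and $w=\sum_\gamma w_\gamma a^\gamma$; the basis elements $g_\sigma^\gamma$ above are pairwise orthogonal for it. **Theorem.** Let $\sigma\in\{+,-\}$ and $\gamma=(\alpha,\beta)$ with $\alpha\ge\beta$, and with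 $\alpha>\beta$ if $\sigma=-$. Let $y_\pm^{(0)}=g_\pm^\gamma$ and $y_{\pm}^{(\ell+1)}=\big[y_{\pm}^{(\ell)},[y_+^{(\ell)},y_-^{(\ell)}]\big]$ for $\ell\ge0$ (the commutator chain of Type II seeded by $g_\pm^\gamma$). If $g_\sigma^\gamma\in\hat A_n^\perp$, then $|\gamma|\ge3$ and, for every integer $\ell\ge0$, $$\deg\big(y_\sigma^{(\ell)}\big)=3^\ell(|\gamma|-2)+2\ \ge\ 3^\ell+2 .$$ In particular, the degrees $\deg(y_\sigma^{(\ell)})$, $\ell\ge0$, are unbounded. -/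

import Mathlib

/-! The `n`-mode Weyl algebra by generators and relations, its basis of normal-ordered monomials,
its adjoint, the skew-hermitian Weyl algebra and its decomposition, and Type II commutator chains. -/

noncomputable section

namespace BosonicWeyl

open Complex

/-- Generators: `cre j` stands for `a_j†` and `ann j` for `a_j`. -/
inductive Gen (n : ℕ) : Type
  | cre (j : Fin n) : Gen n
  | ann (j : Fin n) : Gen n

/-- The canonical commutation relations. -/
inductive CCR (n : ℕ) : FreeAlgebra ℂ (Gen n) → FreeAlgebra ℂ (Gen n) → Prop
  | cre_cre (i j : Fin n) : CCR n
      (FreeAlgebra.ι ℂ (Gen.cre i) * FreeAlgebra.ι ℂ (Gen.cre j))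
      (FreeAlgebra.ι ℂ (Gen.cre j) * FreeAlgebra.ι ℂ (Gen.cre i))
  | ann_ann (i j : Fin n) : CCR n
      (FreeAlgebra.ι ℂ (Gen.ann i) * FreeAlgebra.ι ℂ (Gen.ann j))
      (FreeAlgebra.ι ℂ (Gen.ann j) * FreeAlgebra.ι ℂ (Gen.ann i))
  | ann_cre (i j : Fin n) : CCR n
      (FreeAlgebra.ι ℂ (Gen.ann i) * FreeAlgebra.ι ℂ (Gen.cre j))
      (FreeAlgebra.ι ℂ (Gen.cre j) * FreeAlgebra.ι ℂ (Gen.ann i) + (if i = j then 1 else 0))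

/-- The `n`th Weyl algebra `A_n` over `ℂ`. -/
def Weyl (n : ℕ) : Type := RingQuot (CCR n)

instance (n : ℕ) : Ring (Weyl n) := inferInstanceAs (Ring (RingQuot (CCR n)))

instance (n : ℕ) : Algebra ℂ (Weyl n) := inferInstanceAs (Algebra ℂ (RingQuot (CCR n)))

/-- The Lie bracket is the commutator. -/
instance (n : ℕ) : LieRing (Weyl n) := LieRing.ofAssociativeRing

instance (n : ℕ) : LieAlgebra ℝ (Weyl n) := LieAlgebra.ofAssociativeAlgebra

variable {n : ℕ}

def Weyl.gen (x : Gen n) : Weyl n := RingQuot.mkAlgHom ℂ (CCR n) (FreeAlgebra.ι ℂ x)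

/-- The creation operator `a_j†`. -/
def cre (j : Fin n) : Weyl n := Weyl.gen (Gen.cre j)

/-- The annihilation operator `a_j`. -/
def ann (j : Fin n) : Weyl n := Weyl.gen (Gen.ann j)

theorem cre_comm (i j : Fin n) : cre i * cre j = cre j * cre i := by
  have h := RingQuot.mkAlgHom_rel ℂ (CCR.cre_cre i j)
  rw [map_mul, map_mul] at h
  exact h

theorem ann_comm (i j : Fin n) : ann i * ann j = ann j * ann i := by
  have h := RingQuot.mkAlgHom_rel ℂ (CCR.ann_ann i j)
  rw [map_mul, map_mul] at h
  exact h

theorem ann_cre (i j : Fin n) :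
    ann i * cre j = cre j * ann i + (if i = j then 1 else 0) := by
  have h := RingQuot.mkAlgHom_rel ℂ (CCR.ann_cre i j)
  rw [map_mul, map_add, map_mul, apply_ite (RingQuot.mkAlgHom ℂ (CCR n)), map_one, map_zero] at h
  exact h

/-- Universal property of the Weyl algebra. -/
def Weyl.lift {B : Type} [Ring B] [Algebra ℂ B] (c d : Fin n → B)
    (hcc : ∀ i j, c i * c j = c j * c i) (hdd : ∀ i j, d i * d j = d j * d i)
    (hdc : ∀ i j, d i * c j = c j * d i + (if i = j then 1 else 0)) : Weyl n →ₐ[ℂ] B :=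
  RingQuot.liftAlgHom ℂ (s := CCR n)
    ⟨FreeAlgebra.lift ℂ (fun x => match x with
      | Gen.cre j => c j
      | Gen.ann j => d j), by
      intro x y h
      cases h with
      | cre_cre i j => simpa using hcc i j
      | ann_ann i j => simpa using hdd i j
      | ann_cre i j =>
        have := hdc i j
        split_ifs at this ⊢ <;> simpa using this⟩

theorem Weyl.lift_cre {B : Type} [Ring B] [Algebra ℂ B] (c d : Fin n → B) (hcc hdd hdc)
    (j : Fin n) : Weyl.lift c d hcc hdd hdc (cre j) = c j := by
  unfold Weyl.lift cre Weyl.gen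
  erw [RingQuot.liftAlgHom_mkAlgHom_apply]
  simp

theorem Weyl.lift_ann {B : Type} [Ring B] [Algebra ℂ B] (c d : Fin n → B) (hcc hdd hdc)
    (j : Fin n) : Weyl.lift c d hcc hdd hdc (ann j) = d j := by
  unfold Weyl.lift ann Weyl.gen
  erw [RingQuot.liftAlgHom_mkAlgHom_apply]
  simp

theorem Weyl.hom_ext {B : Type} [Ring B] [Algebra ℂ B] {f g : Weyl n →ₐ[ℂ] B}
    (hc : ∀ j, f (cre j) = g (cre j)) (ha : ∀ j, f (ann j) = g (ann j)) : f = g := by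
  refine RingQuot.ringQuot_ext' ℂ (s := CCR n) f g ?_
  apply FreeAlgebra.hom_ext
  funext x
  cases x with
  | cre j => exact hc j
  | ann j => exact ha j

theorem Weyl.subalgebra_eq_top (S : Subalgebra ℂ (Weyl n)) (hc : ∀ j, cre j ∈ S)
    (ha : ∀ j, ann j ∈ S) (x : Weyl n) : x ∈ S := by
  let f : Weyl n →ₐ[ℂ] S := Weyl.lift (fun j => ⟨cre j, hc j⟩) (fun j => ⟨ann j, ha j⟩)
    (fun i j => Subtype.ext (cre_comm i j)) (fun i j => Subtype.ext (ann_comm i j))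
    (fun i j => by
      apply Subtype.ext
      have := ann_cre i j
      split_ifs at this ⊢ <;> simpa using this)
  have h : S.val.comp f = AlgHom.id ℂ (Weyl n) := by
    apply Weyl.hom_ext
    · intro j
      simp [f, Weyl.lift_cre]
    · intro j
      simp [f, Weyl.lift_ann]
  have hx := DFunLike.congr_fun h x
  simp only [AlgHom.comp_apply, AlgHom.id_apply] at hx
  rw [← hx]
  exact (f x).2

/-! ### The adjoint -/

/-- The opposite algebra of `B`, with scalars acting through complex conjugation: algebra
homomorphisms into it are conjugate-linear anti-homomorphisms into `B`. -/
def ConjOp (B : Type) : Type := Bᵐᵒᵖ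

instance (B : Type) [Ring B] : Ring (ConjOp B) := inferInstanceAs (Ring Bᵐᵒᵖ)

instance (B : Type) [Ring B] [Algebra ℂ B] : Algebra ℂ (ConjOp B) :=
  RingHom.toAlgebra' (((algebraMap ℂ Bᵐᵒᵖ).comp (starRingEnd ℂ) : ℂ →+* Bᵐᵒᵖ) : ℂ →+* ConjOp B)
    (fun c x => Algebra.commutes (A := Bᵐᵒᵖ) (starRingEnd ℂ c) x)

/-- The conjugate-linear anti-homomorphism exchanging `a_j` and `a_j†`. -/
def adjointHom (n : ℕ) : Weyl n →ₐ[ℂ] ConjOp (Weyl n) :=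
  Weyl.lift (B := ConjOp (Weyl n)) (fun j => MulOpposite.op (ann j))
    (fun j => MulOpposite.op (cre j))
    (fun i j => congrArg MulOpposite.op (ann_comm j i))
    (fun i j => congrArg MulOpposite.op (cre_comm j i))
    (fun i j => by
      have h := congrArg MulOpposite.op (ann_cre j i)
      by_cases hij : i = j
      · subst hij
        simp only [if_true] at h ⊢
        exact h
      · simp only [if_neg hij, if_neg (Ne.symm hij)] at h ⊢
        exact h)

instance (n : ℕ) : Star (Weyl n) := ⟨fun x => MulOpposite.unop (adjointHom n x : (Weyl n)ᵐᵒᵖ)⟩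

theorem star_cre (j : Fin n) : star (cre j) = ann j :=
  congrArg MulOpposite.unop (Weyl.lift_cre (B := ConjOp (Weyl n)) _ _ _ _ _ j)

theorem star_ann (j : Fin n) : star (ann j) = cre j :=
  congrArg MulOpposite.unop (Weyl.lift_ann (B := ConjOp (Weyl n)) _ _ _ _ _ j)

theorem adj_add (x y : Weyl n) : star (x + y) = star x + star y :=
  congrArg MulOpposite.unop (map_add (adjointHom n) x y)

theorem adj_mul (x y : Weyl n) : star (x * y) = star y * star x :=
  congrArg MulOpposite.unop (map_mul (adjointHom n) x y)

theorem adj_algebraMap (c : ℂ) :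
    star (algebraMap ℂ (Weyl n) c) = algebraMap ℂ (Weyl n) (star c) :=
  congrArg MulOpposite.unop ((adjointHom n).commutes c)

theorem adj_adj (x : Weyl n) : star (star x) = x := by
  let S : Subalgebra ℂ (Weyl n) :=
    { carrier := {x | star (star x) = x}
      mul_mem' := fun {x y} hx hy => by
        simp only [Set.mem_ofPred_eq] at *
        rw [adj_mul, adj_mul, hx, hy]
      add_mem' := fun {x y} hx hy => by
        simp only [Set.mem_ofPred_eq] at *
        rw [adj_add, adj_add, hx, hy]
      algebraMap_mem' := fun c => by
        simp only [Set.mem_ofPred_eq]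
        rw [adj_algebraMap, adj_algebraMap, star_star] }
  exact Weyl.subalgebra_eq_top S (fun j => by
    show star (star (cre j)) = cre j
    rw [star_cre, star_ann]) (fun j => by
    show star (star (ann j)) = ann j
    rw [star_ann, star_cre]) x

/-- `†` is an involutive, conjugate-linear anti-automorphism with `(a_j)† = a_j†`. -/
instance (n : ℕ) : StarRing (Weyl n) where
  star_involutive := adj_adj
  star_mul := adj_mul
  star_add := adj_add

instance (n : ℕ) : StarModule ℂ (Weyl n) where
  star_smul c x := by
    rw [Algebra.smul_def, star_mul, adj_algebraMap, Algebra.smul_def, Algebra.commutes]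

/-! ### Normal-ordered monomials -/

/-- A multi-index `γ = (α, β)`. -/
abbrev MIdx (n : ℕ) : Type := (Fin n → ℕ) × (Fin n → ℕ)

/-- `|γ|`. -/
def MIdx.size (γ : MIdx n) : ℕ := (∑ j, γ.1 j) + ∑ j, γ.2 j

/-- The ordered product `x_1 ^ α_1 ⋯ x_n ^ α_n`. -/
def ordProd {M : Type} [Monoid M] {n : ℕ} (x : Fin n → M) (α : Fin n → ℕ) : M :=
  (List.ofFn fun j => x j ^ α j).prod

/-- The normal-ordered monomial
`a^γ = (a_1†)^{α_1} ⋯ (a_n†)^{α_n} (a_1)^{β_1} ⋯ (a_n)^{β_n}`. -/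
def nmon (γ : MIdx n) : Weyl n := ordProd cre γ.1 * ordProd ann γ.2

theorem ordProd_zero {M : Type} [Monoid M] (x : Fin n → M) : ordProd x 0 = 1 := by
  unfold ordProd
  apply List.prod_eq_one
  intro y hy
  rw [List.mem_ofFn] at hy
  obtain ⟨j, rfl⟩ := hy
  simp

theorem mul_ordProd {M : Type} [Monoid M] {n : ℕ} (x : Fin n → M)
    (hx : ∀ i j, x i * x j = x j * x i) (α : Fin n → ℕ) (j : Fin n) :
    x j * ordProd x α = ordProd x (α + Pi.single j 1) := by
  induction n with
  | zero => exact j.elim0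
  | succ n ih =>
    unfold ordProd at ih ⊢
    rw [List.ofFn_succ, List.ofFn_succ, List.prod_cons, List.prod_cons]
    refine Fin.cases ?_ (fun i => ?_) j
    · rw [← mul_assoc, ← pow_succ']
      simp
    · have h := ih (fun k => x k.succ) (fun a b => hx _ _) (fun k => α k.succ) i
      have hc : Commute (x i.succ) (x 0 ^ α 0) := Commute.pow_right (hx _ _) _
      rw [← mul_assoc, hc.eq, mul_assoc, h]
      congr 1
      · simp [Pi.single_apply]

theorem idx_induction {P : (Fin n → ℕ) → Prop} (h0 : P 0)
    (hs : ∀ α j, P α → P (α + Pi.single j 1)) (α : Fin n → ℕ) : P α := by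
  obtain ⟨k, hk⟩ : ∃ k, ∑ j, α j = k := ⟨_, rfl⟩
  induction k generalizing α with
  | zero =>
    have : α = 0 := by
      funext j
      exact Finset.sum_eq_zero_iff.mp hk j (Finset.mem_univ j)
    rw [this]
    exact h0
  | succ k ih =>
    obtain ⟨j, -, hj⟩ : ∃ j ∈ Finset.univ, α j ≠ 0 := by
      apply Finset.exists_ne_zero_of_sum_ne_zero
      omega
    have hα : (α - Pi.single j 1) + Pi.single j 1 = α := by
      funext i
      by_cases h : i = j
      · subst h
        simp only [Pi.add_apply, Pi.sub_apply, Pi.single_eq_same]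
        omega
      · simp [h]
    rw [← hα]
    apply hs
    apply ih
    have h2 : ∑ i, ((α - Pi.single j 1) + Pi.single j 1 : Fin n → ℕ) i = k + 1 := by
      rw [hα, hk]
    simp only [Pi.add_apply, Finset.sum_add_distrib, Finset.sum_pi_single', Finset.mem_univ,
      if_true] at h2
    omega

theorem nmon_span (x : Weyl n) : x ∈ Submodule.span ℂ (Set.range (nmon (n := n))) := by
  set S := Submodule.span ℂ (Set.range (nmon (n := n))) with hS
  have hcre : ∀ j, ∀ s ∈ S, cre j * s ∈ S := by
    intro j s hs
    induction hs using Submodule.span_induction with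
    | mem s hs =>
      obtain ⟨γ, rfl⟩ := hs
      refine Submodule.subset_span ⟨(γ.1 + Pi.single j 1, γ.2), ?_⟩
      simp only [nmon]
      rw [← mul_ordProd cre cre_comm, mul_assoc]
    | zero => simp
    | add a b _ _ ha hb => rw [mul_add]; exact S.add_mem ha hb
    | smul c a _ ha => rw [mul_smul_comm]; exact S.smul_mem c ha
  have hann : ∀ j, ∀ s ∈ S, ann j * s ∈ S := by
    intro j s hs
    induction hs using Submodule.span_induction with
    | mem s hs =>
      obtain ⟨⟨α, β⟩, rfl⟩ := hs
      induction α using idx_induction with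
      | h0 =>
        refine Submodule.subset_span ⟨(0, β + Pi.single j 1), ?_⟩
        simp only [nmon, ordProd_zero, one_mul]
        rw [← mul_ordProd ann ann_comm]
      | hs α i ih =>
        have h : nmon (α + Pi.single i 1, β) = cre i * nmon (α, β) := by
          simp only [nmon]
          rw [← mul_ordProd cre cre_comm, mul_assoc]
        have hm : nmon (α, β) ∈ S := Submodule.subset_span ⟨_, rfl⟩
        rw [h, ← mul_assoc, ann_cre, add_mul, mul_assoc]
        refine S.add_mem (hcre i _ ih) ?_
        split_ifs
        · simpa using hm
        · simp
    | zero => simp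
    | add a b _ _ ha hb => rw [mul_add]; exact S.add_mem ha hb
    | smul c a _ ha => rw [mul_smul_comm]; exact S.smul_mem c ha
  let T : Subalgebra ℂ (Weyl n) :=
    { carrier := {x | ∀ s ∈ S, x * s ∈ S}
      mul_mem' := fun {x y} hx hy s hs => by rw [mul_assoc]; exact hx _ (hy _ hs)
      add_mem' := fun {x y} hx hy s hs => by rw [add_mul]; exact S.add_mem (hx _ hs) (hy _ hs)
      algebraMap_mem' := fun c s hs => by rw [← Algebra.smul_def]; exact S.smul_mem c hs }
  have h1 : (1 : Weyl n) ∈ S :=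
    Submodule.subset_span ⟨(0, 0), by simp [nmon, ordProd_zero]⟩
  have := Weyl.subalgebra_eq_top T hcre hann x 1 h1
  rwa [mul_one] at this

/-- The representation of `A_n` by polynomial differential operators. -/
def polyRep (n : ℕ) : Weyl n →ₐ[ℂ] Module.End ℂ (MvPolynomial (Fin n) ℂ) :=
  Weyl.lift (fun j => LinearMap.mulLeft ℂ (MvPolynomial.X j))
    (fun j => (MvPolynomial.pderiv j).toLinearMap)
    (fun i j => by
      apply LinearMap.ext
      intro p
      simp only [Module.End.mul_apply, LinearMap.mulLeft_apply]
      ring)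
    (fun i j => by
      apply MvPolynomial.linearMap_ext
      intro s
      apply LinearMap.ext
      intro c
      simp only [LinearMap.comp_apply, Module.End.mul_apply, Derivation.coeFn_coe,
        MvPolynomial.pderiv_monomial]
      by_cases h : i = j
      · subst h
        rfl
      · congr 1
        · rw [tsub_right_comm]
        · simp [h, Ne.symm h]
          ring)
    (fun i j => by
      apply LinearMap.ext
      intro p
      simp only [Module.End.mul_apply, LinearMap.mulLeft_apply, Derivation.coeFn_coe,
        Derivation.leibniz, LinearMap.add_apply, MvPolynomial.pderiv_X, smul_eq_mul]
      by_cases h : i = j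
      · subst h
        simp
      · simp [h, Ne.symm h])

/-- A multi-index as a finitely supported function. -/
def toFs (α : Fin n → ℕ) : Fin n →₀ ℕ := Finsupp.equivFunOnFinite.symm α

theorem polyRep_cre (α : Fin n → ℕ) (s : Fin n →₀ ℕ) (c : ℂ) :
    polyRep n (ordProd cre α) (MvPolynomial.monomial s c) =
      MvPolynomial.monomial (toFs α + s) c := by
  induction α using idx_induction with
  | h0 =>
    have : toFs (0 : Fin n → ℕ) = 0 := by
      ext
      simp [toFs]
    simp [ordProd_zero, this]
  | hs α j ih =>
    rw [← mul_ordProd cre cre_comm, map_mul, Module.End.mul_apply, ih]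
    have hc : polyRep n (cre j) = LinearMap.mulLeft ℂ (MvPolynomial.X j) := Weyl.lift_cre _ _ _ _ _ j
    rw [hc, LinearMap.mulLeft_apply, MvPolynomial.X, MvPolynomial.monomial_mul, one_mul]
    refine congrArg (fun t => MvPolynomial.monomial t c) (Finsupp.ext fun i => ?_)
    simp only [toFs, Finsupp.add_apply, Finsupp.single_apply, Pi.add_apply, Pi.single_apply,
      Finsupp.equivFunOnFinite_symm_apply_apply, eq_comm (a := j)]
    ring

theorem polyRep_ann (β : Fin n → ℕ) (s : Fin n →₀ ℕ) (c : ℂ) :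
    polyRep n (ordProd ann β) (MvPolynomial.monomial s c) =
      MvPolynomial.monomial (s - toFs β) (c * ∏ i, ((s i).descFactorial (β i) : ℂ)) := by
  induction β using idx_induction with
  | h0 =>
    have : toFs (0 : Fin n → ℕ) = 0 := by
      ext
      simp [toFs]
    simp [ordProd_zero, this]
  | hs β j ih =>
    rw [← mul_ordProd ann ann_comm, map_mul, Module.End.mul_apply, ih]
    have hc : polyRep n (ann j) = (MvPolynomial.pderiv j).toLinearMap := Weyl.lift_ann _ _ _ _ _ j
    rw [hc, Derivation.coeFn_coe, MvPolynomial.pderiv_monomial]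
    refine congrArg₂ (fun t d => MvPolynomial.monomial t d) (Finsupp.ext fun i => ?_) ?_
    · by_cases h : i = j
      · subst h
        simp only [toFs, Finsupp.tsub_apply, Finsupp.single_eq_same, Pi.add_apply,
          Pi.single_eq_same, Finsupp.equivFunOnFinite_symm_apply_apply]
        omega
      · simp [toFs, h]
    · rw [mul_assoc]
      congr 1
      rw [← Finset.mul_prod_erase _ _ (Finset.mem_univ j),
        ← Finset.mul_prod_erase _ _ (Finset.mem_univ j)]
      have h2 : ∏ x ∈ Finset.univ.erase j, ((s x).descFactorial ((β + Pi.single j 1 : Fin n → ℕ) x) : ℂ) =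
          ∏ x ∈ Finset.univ.erase j, ((s x).descFactorial (β x) : ℂ) := by
        apply Finset.prod_congr rfl
        intro x hx
        have hxj := (Finset.mem_erase.mp hx).1
        simp [hxj]
      rw [h2]
      simp only [Pi.add_apply, Pi.single_eq_same, Nat.descFactorial_succ, toFs, Nat.cast_mul,
        Finsupp.coe_tsub, Pi.sub_apply, Finsupp.equivFunOnFinite_symm_apply_apply]
      ring

theorem polyRep_ann_eq_zero (β δ : Fin n → ℕ) (hne : β ≠ δ)
    (hle : ∑ j, δ j ≤ ∑ j, β j) (c : ℂ) :
    polyRep n (ordProd ann β) (MvPolynomial.monomial (toFs δ) c) = 0 := by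
  obtain ⟨i, hi⟩ : ∃ i, δ i < β i := by
    by_contra hcon
    push Not at hcon
    apply hne
    funext i
    have h1 : ∑ j, β j = ∑ j, δ j :=
      le_antisymm (Finset.sum_le_sum fun j _ => hcon j) hle
    exact (Finset.sum_eq_sum_iff_of_le (fun j _ => hcon j)).mp h1 i (Finset.mem_univ i)
  rw [polyRep_ann]
  have : ∏ k, (((toFs δ) k).descFactorial (β k) : ℂ) = 0 := by
    apply Finset.prod_eq_zero (Finset.mem_univ i)
    simp [toFs, Nat.descFactorial_eq_zero_iff_lt.mpr hi]
  rw [this, mul_zero, map_zero]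

theorem nmon_linearIndependent : LinearIndependent ℂ (nmon (n := n)) := by
  rw [linearIndependent_iff]
  intro l hl
  by_contra hne
  obtain ⟨γ₀, hγ₀, hmin⟩ := Finset.exists_min_image l.support (fun γ => ∑ j, γ.2 j)
    (Finsupp.support_nonempty_iff.mpr hne)
  have h := congrArg (fun x => MvPolynomial.coeff (toFs γ₀.1)
    (polyRep n x (MvPolynomial.monomial (toFs γ₀.2) 1))) hl
  simp only [map_zero, LinearMap.zero_apply, MvPolynomial.coeff_zero] at h
  rw [Finsupp.linearCombination_apply, Finsupp.sum, map_sum, LinearMap.sum_apply,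
    MvPolynomial.coeff_sum, Finset.sum_eq_single γ₀] at h
  · rw [nmon, map_smul, map_mul, LinearMap.smul_apply, Module.End.mul_apply, polyRep_ann,
      polyRep_cre, tsub_self, add_zero, MvPolynomial.coeff_smul, MvPolynomial.coeff_monomial,
      if_pos rfl, one_mul, smul_eq_mul, mul_eq_zero, Finset.prod_eq_zero_iff] at h
    rcases h with h | ⟨i, -, h⟩
    · exact (Finsupp.mem_support_iff.mp hγ₀) h
    · simp [toFs, Nat.descFactorial_self, Nat.factorial_ne_zero] at h
  · intro γ hγ hne'
    rw [nmon, map_smul, map_mul, LinearMap.smul_apply, Module.End.mul_apply,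
      MvPolynomial.coeff_smul]
    by_cases hb : γ.2 = γ₀.2
    · have ha : toFs γ.1 ≠ toFs γ₀.1 := by
        intro ha
        apply hne'
        exact Prod.ext (Finsupp.equivFunOnFinite.symm.injective ha) hb
      rw [hb, polyRep_ann, polyRep_cre, tsub_self, add_zero, MvPolynomial.coeff_monomial,
        if_neg ha, smul_zero]
    · rw [polyRep_ann_eq_zero _ _ hb (hmin γ hγ), map_zero, MvPolynomial.coeff_zero, smul_zero]
  · intro hc
    exact absurd hγ₀ hc

/-- The normal-ordered monomials form a basis of `A_n`; coordinates in it are the coefficients of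
the normal-ordered (canonical) form. -/
def nbasis (n : ℕ) : Module.Basis (MIdx n) ℂ (Weyl n) :=
  Module.Basis.mk nmon_linearIndependent (fun x _ => nmon_span x)

/-- The degree of `g`, with `deg 0 = -∞`. -/
def deg (g : Weyl n) : WithBot ℕ :=
  ((nbasis n).repr g).support.sup fun γ => (γ.size : WithBot ℕ)

/-! ### The skew-hermitian Weyl algebra -/

/-- The skew-hermitian Weyl algebra `Â_n`, as a real Lie algebra under the commutator. -/
def skewWeyl (n : ℕ) : LieSubalgebra ℝ (Weyl n) where
  carrier := {g | star g = -g}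
  add_mem' := fun {x y} hx hy => by
    simp only [Set.mem_ofPred_eq] at *
    rw [star_add, hx, hy, neg_add]
  zero_mem' := by simp
  smul_mem' := fun c x hx => by
    simp only [Set.mem_ofPred_eq] at *
    rw [star_smul, hx, smul_neg, star_trivial]
  lie_mem' := fun {x y} hx hy => by
    simp only [Set.mem_ofPred_eq, Ring.lie_def] at *
    rw [star_sub, star_mul, star_mul, hx, hy]
    simp

/-- The two signs labelling basis elements. -/
inductive Sgn : Type
  | plus : Sgn
  | minus : Sgn

/-- `g_+^γ = i ((a^γ)† + a^γ)` and `g_-^γ = (a^γ)† - a^γ`. -/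
def g : Sgn → MIdx n → Weyl n
  | Sgn.plus, γ => I • (star (nmon γ) + nmon γ)
  | Sgn.minus, γ => star (nmon γ) - nmon γ

/-- `⟨v, w⟩ = Re ∑_γ conj (v_γ) w_γ` with `v_γ`, `w_γ` the coefficients of the normal-ordered forms.
The basis elements `g_σ^γ` of `Â_n` are pairwise orthogonal and nonisotropic for it. -/
def scalarProd (v w : Weyl n) : ℝ :=
  (((nbasis n).repr v).sum fun γ c => star c * (nbasis n).repr w γ).re

/-- Span of `2i` and the `2i a_k† a_k`. -/
def space0 (n : ℕ) : Submodule ℝ (Weyl n) :=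
  Submodule.span ℝ ({(2 * I : ℂ) • (1 : Weyl n)} ∪
    Set.range fun k : Fin n => (2 * I : ℂ) • (cre k * ann k))

/-- The real span of the `g_σ^γ`, `σ = ±`, over the multi-indices `γ` with property `P`. -/
def spanOf (P : MIdx n → Prop) : Submodule ℝ (Weyl n) :=
  Submodule.span ℝ {x | ∃ (σ : Sgn) (γ : MIdx n), P γ ∧ x = g σ γ}

def space1 (n : ℕ) : Submodule ℝ (Weyl n) := spanOf fun γ => γ.size = 1

def space2 (n : ℕ) : Submodule ℝ (Weyl n) := spanOf fun γ => γ.size = 2 ∧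
  ((Finset.univ.filter fun k => γ.1 k ≠ γ.2 k).card = 1 ∨
    (Finset.univ.filter fun k => γ.1 k ≠ γ.2 k).card = 2)

def spaceEq (n : ℕ) : Submodule ℝ (Weyl n) := spanOf fun γ => γ.1 = γ.2 ∧ 4 ≤ γ.size

def spaceOm (n : ℕ) : Submodule ℝ (Weyl n) := spanOf fun γ => 3 ≤ γ.size ∧
  ∃! k, γ.1 k + γ.2 k = 1 ∧ ∀ j, j ≠ k → γ.1 j = γ.2 j

/-- `Â_n^core`. -/
def core (n : ℕ) : Submodule ℝ (Weyl n) :=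
  space0 n ⊔ space1 n ⊔ space2 n ⊔ spaceEq n ⊔ spaceOm n

/-- `Â_n^⊥`, the orthogonal complement of `Â_n^core` in `Â_n`. -/
def perp (n : ℕ) : Submodule ℝ (Weyl n) where
  carrier := {x | x ∈ skewWeyl n ∧ ∀ w ∈ core n, scalarProd w x = 0}
  add_mem' := fun {x y} hx hy => ⟨add_mem hx.1 hy.1, fun w hw => by
    have h1 := hx.2 w hw
    have h2 := hy.2 w hw
    simp only [scalarProd, Finsupp.sum] at *
    simp only [map_add, Finsupp.add_apply, mul_add, Finset.sum_add_distrib, Complex.add_re, h1, h2,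
      add_zero]⟩
  zero_mem' := ⟨zero_mem _, fun w _ => by simp [scalarProd, Finsupp.sum]⟩
  smul_mem' := fun c x hx => ⟨(skewWeyl n).smul_mem c hx.1, fun w hw => by
    have h1 := hx.2 w hw
    have hc : c • x = (c : ℂ) • x := (Complex.coe_smul c x).symm
    simp only [scalarProd, Finsupp.sum] at *
    simp only [hc, map_smul, Finsupp.smul_apply, smul_eq_mul, mul_left_comm _ (c : ℂ)]
    rw [← Finset.mul_sum, Complex.re_ofReal_mul, h1, mul_zero]⟩

/-- The Type II commutator chain: `y_σ^(0) = g_σ^γ` and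
`y_σ^(ℓ+1) = [y_σ^(ℓ), [y_+^(ℓ), y_-^(ℓ)]]`. -/
def chainII (γ : MIdx n) : ℕ → Sgn → Weyl n
  | 0, σ => g σ γ
  | ℓ + 1, σ => ⁅chainII γ ℓ σ, ⁅chainII γ ℓ Sgn.plus, chainII γ ℓ Sgn.minus⁆⁆

end BosonicWeyl

end

/-!
The proof passes to principal symbols. With respect to the degree filtration `filt`, the Weyl
algebra has the commutative polynomial ring in `z_j` (for `a_j†`) and `w_j` (for `a_j`) as its
associated graded algebra, and a commutator of elements of degrees `d` and `e` has degree at most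
`d + e - 2`, its part of that degree being the Poisson bracket of the two symbols
(`lie_mem_filt_and_symb_lie`). The step of the chain therefore takes degree `d` to at most
`3 d - 4`, which is the recursion solved by `3 ^ ℓ (|γ| - 2) + 2`; the point is that the symbol in
this degree never vanishes.

Write `m = z^α w^β`, `m' = z^β w^α`, `N_j = z_j w_j`, and let `D = ∑_j (β_j - α_j) ∂/∂N_j`. For a
polynomial `R` in the `N_j` one has `{m, R} = (D R) m` and `{m', R} = -(D R) m'`, and polynomials in
the `N_j` Poisson-commute. Since `m m' = N^(α+β)`, it follows that
`{p m, p m'} = D (p² N^(α+β))` (`poisson_mono_mono_swap`). Hence the symbols of the two elements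
of the chain keep the shape `p (m' + ε m)` and `c p (m' - ε m)`, and a step replaces `p` by a
nonzero multiple of `p D² (p² N^(α+β))` (`poisson_chain_step`).

So `D²` must not kill `p² N^(α+β)`. Restricting to lines in the direction `β - α`, where `D` is
the derivative of a one-variable polynomial, the degree of `p² N^(α+β)` is at least that of
`N^(α+β)`, namely the sum of the `α_j + β_j` over the indices with `α_j ≠ β_j`
(`weightDeriv_weightDeriv_ne_zero`). This number is at least two exactly when `α ≠ β` and it is not
the case that `α` and `β` differ at a single index `k` with `α_k + β_k = 1`. Orthogonality to
`spaceEq` and `spaceOm`, and to the parts of the core with `|γ| ≤ 2`, excludes the other cases,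
because `g_σ^γ` is not orthogonal to itself (`size_and_sum_of_mem_perp`).
-/

noncomputable section
namespace BosonicWeyl
open Complex
open MvPolynomial (X C monomial pderiv)
variable {n : ℕ}

/-! ### Multiplication and commutation with generators in normal-ordered form -/

theorem commute_ordProd {M : Type} [Monoid M] (x : Fin n → M)
    (hx : ∀ i j, x i * x j = x j * x i) (j : Fin n) (α : Fin n → ℕ) :
    Commute (x j) (ordProd x α) := by
  induction α using idx_induction with
  | h0 => rw [ordProd_zero]; exact Commute.one_right _
  | hs α i ih => rw [← mul_ordProd x hx]; exact Commute.mul_right (hx j i) ih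

theorem add_single_sub_single (α : Fin n → ℕ) {i j : Fin n} (h : i ≠ j) (hα : α i ≠ 0) :
    α - Pi.single i 1 + Pi.single j 1 = α + Pi.single j 1 - Pi.single i 1 := by
  funext k
  by_cases hk : k = i
  · subst hk
    simp [h]
  · simp [Pi.single_apply, hk]

theorem sub_single_add_single {α : Fin n → ℕ} {j : Fin n} (h : α j ≠ 0) :
    α - Pi.single j 1 + Pi.single j 1 = α := by
  funext k
  by_cases hk : k = j
  · subst hk; simp only [Pi.add_apply, Pi.sub_apply, Pi.single_eq_same]; omega
  · simp [hk]

theorem ann_mul_ordProd_cre (j : Fin n) (α : Fin n → ℕ) :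
    ann j * ordProd cre α =
      ordProd cre α * ann j + (α j : ℂ) • ordProd cre (α - Pi.single j 1) := by
  induction α using idx_induction with
  | h0 => simp [ordProd_zero]
  | hs α i ih =>
    rw [← mul_ordProd cre cre_comm, ← mul_assoc, ann_cre, add_mul, mul_assoc, ih, mul_add,
      ← mul_assoc, mul_smul_comm, mul_ordProd cre cre_comm, mul_ordProd cre cre_comm, add_assoc]
    congr 1
    by_cases h : j = i
    · subst h
      by_cases h0 : α j = 0
      · simp [h0]
      · simp [sub_single_add_single h0, add_smul]
    · by_cases h0 : α j = 0
      · simp [h0, h]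
      · simp [h, add_single_sub_single α h h0]

theorem ordProd_ann_mul_cre (j : Fin n) (β : Fin n → ℕ) :
    ordProd ann β * cre j =
      cre j * ordProd ann β + (β j : ℂ) • ordProd ann (β - Pi.single j 1) := by
  induction β using idx_induction with
  | h0 => simp [ordProd_zero]
  | hs β i ih =>
    rw [← mul_ordProd ann ann_comm, mul_assoc, ih, mul_add, ← mul_assoc, ann_cre, add_mul,
      mul_smul_comm, mul_ordProd ann ann_comm, mul_assoc, mul_ordProd ann ann_comm, add_assoc]
    congr 1
    by_cases h : j = i
    · subst h
      by_cases h0 : β j = 0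
      · simp [h0]
      · simp [sub_single_add_single h0, add_smul, add_comm]
    · by_cases h0 : β j = 0
      · simp [h0, h, Ne.symm h]
      · simp [h, Ne.symm h, add_single_sub_single β h h0]

theorem cre_mul_nmon (j : Fin n) (γ : MIdx n) :
    cre j * nmon γ = nmon (γ.1 + Pi.single j 1, γ.2) := by
  rw [nmon, nmon, ← mul_assoc, mul_ordProd cre cre_comm]

theorem ann_mul_nmon (j : Fin n) (γ : MIdx n) :
    ann j * nmon γ = nmon (γ.1, γ.2 + Pi.single j 1) +
      (γ.1 j : ℂ) • nmon (γ.1 - Pi.single j 1, γ.2) := by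
  simp only [nmon]
  rw [← mul_assoc, ann_mul_ordProd_cre, add_mul, mul_assoc, mul_ordProd ann ann_comm,
    smul_mul_assoc]

theorem lie_ann_nmon (j : Fin n) (γ : MIdx n) :
    ⁅ann j, nmon γ⁆ = (γ.1 j : ℂ) • nmon (γ.1 - Pi.single j 1, γ.2) := by
  rw [Ring.lie_def, ann_mul_nmon]
  simp only [nmon]
  rw [mul_assoc, ← (commute_ordProd ann ann_comm j γ.2).eq, mul_ordProd ann ann_comm,
    add_sub_cancel_left]

theorem lie_cre_nmon (j : Fin n) (γ : MIdx n) :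
    ⁅cre j, nmon γ⁆ = -((γ.2 j : ℂ) • nmon (γ.1, γ.2 - Pi.single j 1)) := by
  rw [Ring.lie_def]
  simp only [nmon]
  rw [mul_assoc, ordProd_ann_mul_cre, mul_add, ← mul_assoc, ← mul_assoc,
    (commute_ordProd cre cre_comm j γ.1).eq, mul_smul_comm]
  abel

theorem star_ordProd (x : Fin n → Weyl n) (hx : ∀ i j, x i * x j = x j * x i)
    (α : Fin n → ℕ) : star (ordProd x α) = ordProd (fun j => star (x j)) α := by
  have hs : ∀ i j, star (x i) * star (x j) = star (x j) * star (x i) := fun i j => by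
    rw [← star_mul, ← star_mul, hx]
  induction α using idx_induction with
  | h0 => simp [ordProd_zero]
  | hs α j ih =>
    rw [← mul_ordProd x hx, star_mul, ih, ← mul_ordProd _ hs,
      (commute_ordProd _ hs j α).eq]

theorem star_nmon (γ : MIdx n) : star (nmon γ) = nmon γ.swap := by
  rw [nmon, star_mul, star_ordProd _ cre_comm, star_ordProd _ ann_comm]
  simp only [star_cre, star_ann, nmon, Prod.fst_swap, Prod.snd_swap]

/-! ### The Bernstein filtration and principal symbols -/

/-- The exponent of a multi-index in the variables `z_j = inl j` and `w_j = inr j`. -/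
def MIdx.exponent (γ : MIdx n) : Fin n ⊕ Fin n →₀ ℕ :=
  Finsupp.equivFunOnFinite.symm (Sum.elim γ.1 γ.2)

theorem MIdx.exponent_injective : Function.Injective (MIdx.exponent (n := n)) := by
  intro γ δ h
  have h' := Finsupp.equivFunOnFinite.symm.injective h
  refine Prod.ext (funext fun j => ?_) (funext fun j => ?_)
  · exact congrFun h' (Sum.inl j)
  · exact congrFun h' (Sum.inr j)

/-- The commutative monomial `z^α w^β`. -/
def MIdx.mono (γ : MIdx n) : MvPolynomial (Fin n ⊕ Fin n) ℂ := monomial γ.exponent 1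

theorem X_inl_mul_mono (j : Fin n) (γ : MIdx n) :
    X (Sum.inl j) * γ.mono = MIdx.mono (γ.1 + Pi.single j 1, γ.2) := by
  rw [MIdx.mono, MIdx.mono, X, MvPolynomial.monomial_mul, one_mul]
  congr 2
  ext (i | i) <;> simp [MIdx.exponent, Finsupp.single_apply, Pi.single_apply, add_comm, eq_comm]

theorem X_inr_mul_mono (j : Fin n) (γ : MIdx n) :
    X (Sum.inr j) * γ.mono = MIdx.mono (γ.1, γ.2 + Pi.single j 1) := by
  rw [MIdx.mono, MIdx.mono, X, MvPolynomial.monomial_mul, one_mul]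
  congr 2
  ext (i | i) <;> simp [MIdx.exponent, Finsupp.single_apply, Pi.single_apply, add_comm, eq_comm]

theorem pderiv_inl_mono (j : Fin n) (γ : MIdx n) :
    pderiv (Sum.inl j) γ.mono = (γ.1 j : ℂ) • MIdx.mono (γ.1 - Pi.single j 1, γ.2) := by
  rw [MIdx.mono, MIdx.mono, MvPolynomial.pderiv_monomial, MvPolynomial.smul_monomial]
  refine congrArg₂ (fun s c => monomial s c) ?_ ?_
  · ext (i | i) <;> simp [MIdx.exponent, Finsupp.single_apply, Pi.single_apply, eq_comm]
  · simp [MIdx.exponent]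

theorem pderiv_inr_mono (j : Fin n) (γ : MIdx n) :
    pderiv (Sum.inr j) γ.mono = (γ.2 j : ℂ) • MIdx.mono (γ.1, γ.2 - Pi.single j 1) := by
  rw [MIdx.mono, MIdx.mono, MvPolynomial.pderiv_monomial, MvPolynomial.smul_monomial]
  refine congrArg₂ (fun s c => monomial s c) ?_ ?_
  · ext (i | i) <;> simp [MIdx.exponent, Finsupp.single_apply, Pi.single_apply, eq_comm]
  · simp [MIdx.exponent]

theorem size_add_left (j : Fin n) (γ : MIdx n) :
    MIdx.size (γ.1 + Pi.single j 1, γ.2) = γ.size + 1 := by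
  simp only [MIdx.size, Pi.add_apply, Finset.sum_add_distrib, Finset.sum_pi_single',
    Finset.mem_univ, if_true]
  omega

theorem size_add_right (j : Fin n) (γ : MIdx n) :
    MIdx.size (γ.1, γ.2 + Pi.single j 1) = γ.size + 1 := by
  simp only [MIdx.size, Pi.add_apply, Finset.sum_add_distrib, Finset.sum_pi_single',
    Finset.mem_univ, if_true]
  omega

theorem size_sub_left {j : Fin n} {γ : MIdx n} (h : γ.1 j ≠ 0) :
    MIdx.size (γ.1 - Pi.single j 1, γ.2) + 1 = γ.size := by
  rw [← size_add_left j (γ.1 - Pi.single j 1, γ.2), sub_single_add_single h]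

theorem size_sub_right {j : Fin n} {γ : MIdx n} (h : γ.2 j ≠ 0) :
    MIdx.size (γ.1, γ.2 - Pi.single j 1) + 1 = γ.size := by
  rw [← size_add_right j (γ.1, γ.2 - Pi.single j 1), sub_single_add_single h]

@[simp] theorem coe_nbasis : ⇑(nbasis n) = nmon := Module.Basis.coe_mk _ _

/-- The Bernstein filtration: the elements of degree at most `d`. -/
def filt (n d : ℕ) : Submodule ℂ (Weyl n) :=
  Submodule.span ℂ (nmon '' {γ | γ.size ≤ d})

theorem nmon_mem_filt {γ : MIdx n} {d : ℕ} (h : γ.size ≤ d) : nmon γ ∈ filt n d :=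
  Submodule.subset_span ⟨γ, h, rfl⟩

theorem filt_mono {d e : ℕ} (h : d ≤ e) : filt n d ≤ filt n e :=
  Submodule.span_mono (Set.image_mono fun _ hγ => le_trans hγ h)

theorem mem_filt_iff {d : ℕ} {x : Weyl n} :
    x ∈ filt n d ↔ ∀ γ, (nbasis n).repr x γ ≠ 0 → γ.size ≤ d := by
  rw [filt, ← coe_nbasis, Module.Basis.mem_span_image]
  exact ⟨fun h γ hγ => h (Finsupp.mem_support_iff.mpr hγ),
    fun h γ hγ => h γ (Finsupp.mem_support_iff.mp hγ)⟩

/-- The symbol of degree `d`: the degree `d` part of the normal-ordered form, read as a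
commutative polynomial in `z_j` (for `a_j†`) and `w_j` (for `a_j`). -/
def symb (n d : ℕ) : Weyl n →ₗ[ℂ] MvPolynomial (Fin n ⊕ Fin n) ℂ :=
  (nbasis n).constr ℂ fun γ => if γ.size = d then γ.mono else 0

theorem symb_nmon (d : ℕ) (γ : MIdx n) :
    symb n d (nmon γ) = if γ.size = d then γ.mono else 0 := by
  rw [← coe_nbasis, symb, Module.Basis.constr_basis]

theorem symb_eq_zero {d e : ℕ} (h : e < d) {x : Weyl n} (hx : x ∈ filt n e) :
    symb n d x = 0 := by
  induction hx using Submodule.span_induction with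
  | mem x hx =>
    obtain ⟨γ, hγ, rfl⟩ := hx
    rw [symb_nmon, if_neg]
    have : γ.size ≤ e := hγ
    omega
  | zero => simp
  | add x y _ _ hx hy => rw [map_add, hx, hy, add_zero]
  | smul c x _ hx => rw [map_smul, hx, smul_zero]

theorem deg_eq_of_symb_ne_zero {d : ℕ} {x : Weyl n} (hx : x ∈ filt n d)
    (h : symb n d x ≠ 0) : deg x = (d : WithBot ℕ) := by
  apply le_antisymm
  · refine Finset.sup_le fun γ hγ => ?_
    exact_mod_cast mem_filt_iff.mp hx γ (Finsupp.mem_support_iff.mp hγ)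
  · rw [symb, Module.Basis.constr_apply] at h
    obtain ⟨γ, hγ, hne⟩ := Finset.exists_ne_zero_of_sum_ne_zero h
    have hd : γ.size = d := by
      by_contra hd
      simp [hd] at hne
    rw [← hd]
    exact Finset.le_sup (f := fun γ : MIdx n => (γ.size : WithBot ℕ)) hγ

theorem cre_mul_mem_filt {d : ℕ} (j : Fin n) {x : Weyl n} (hx : x ∈ filt n d) :
    cre j * x ∈ filt n (d + 1) := by
  induction hx using Submodule.span_induction with
  | mem x hx =>
    obtain ⟨γ, hγ, rfl⟩ := hx
    rw [cre_mul_nmon]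
    exact nmon_mem_filt (by rw [size_add_left]; exact Nat.succ_le_succ hγ)
  | zero => simp
  | add x y _ _ hx hy => rw [mul_add]; exact add_mem hx hy
  | smul c x _ hx => rw [mul_smul_comm]; exact Submodule.smul_mem _ c hx

theorem lie_ann_mem_filt {d : ℕ} (j : Fin n) {x : Weyl n} (hx : x ∈ filt n (d + 1)) :
    ⁅ann j, x⁆ ∈ filt n d := by
  induction hx using Submodule.span_induction with
  | mem x hx =>
    obtain ⟨γ, hγ, rfl⟩ := hx
    rw [lie_ann_nmon]
    by_cases h : γ.1 j = 0
    · simp [h]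
    · refine Submodule.smul_mem _ _ (nmon_mem_filt ?_)
      have h1 := size_sub_left h
      have h2 : γ.size ≤ d + 1 := hγ
      omega
  | zero => simp
  | add x y _ _ hx hy => rw [lie_add]; exact add_mem hx hy
  | smul c x _ hx =>
    rw [Ring.lie_def, mul_smul_comm, smul_mul_assoc, ← smul_sub]
    exact Submodule.smul_mem _ c hx

theorem lie_cre_mem_filt {d : ℕ} (j : Fin n) {x : Weyl n} (hx : x ∈ filt n (d + 1)) :
    ⁅cre j, x⁆ ∈ filt n d := by
  induction hx using Submodule.span_induction with
  | mem x hx =>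
    obtain ⟨γ, hγ, rfl⟩ := hx
    rw [lie_cre_nmon]
    by_cases h : γ.2 j = 0
    · simp [h]
    · refine neg_mem (Submodule.smul_mem _ _ (nmon_mem_filt ?_))
      have h1 := size_sub_right h
      have h2 : γ.size ≤ d + 1 := hγ
      omega
  | zero => simp
  | add x y _ _ hx hy => rw [lie_add]; exact add_mem hx hy
  | smul c x _ hx =>
    rw [Ring.lie_def, mul_smul_comm, smul_mul_assoc, ← smul_sub]
    exact Submodule.smul_mem _ c hx

theorem ann_mul_mem_filt {d : ℕ} (j : Fin n) {x : Weyl n} (hx : x ∈ filt n d) :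
    ann j * x ∈ filt n (d + 1) := by
  induction hx using Submodule.span_induction with
  | mem x hx =>
    obtain ⟨γ, hγ, rfl⟩ := hx
    have h2 : γ.size ≤ d := hγ
    rw [ann_mul_nmon]
    refine add_mem (nmon_mem_filt (by rw [size_add_right]; exact Nat.succ_le_succ hγ)) ?_
    by_cases h : γ.1 j = 0
    · simp [h]
    · refine Submodule.smul_mem _ _ (nmon_mem_filt ?_)
      have h1 := size_sub_left h
      omega
  | zero => simp
  | add x y _ _ hx hy => rw [mul_add]; exact add_mem hx hy
  | smul c x _ hx => rw [mul_smul_comm]; exact Submodule.smul_mem _ c hx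

theorem symb_cre_mul (d : ℕ) (j : Fin n) (x : Weyl n) :
    symb n (d + 1) (cre j * x) = X (Sum.inl j) * symb n d x := by
  induction nmon_span x using Submodule.span_induction with
  | mem x hx =>
    obtain ⟨γ, rfl⟩ := hx
    rw [cre_mul_nmon, symb_nmon, symb_nmon, size_add_left]
    by_cases h : γ.size = d
    · rw [if_pos (by omega), if_pos h, X_inl_mul_mono]
    · rw [if_neg (by omega), if_neg h, mul_zero]
  | zero => simp
  | add x y _ _ hx hy => rw [mul_add, map_add, hx, hy, map_add, mul_add]
  | smul c x _ hx => rw [mul_smul_comm, map_smul, hx, map_smul, mul_smul_comm]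

/-- Normal ordering `a_j x` only creates terms of degree two less than the leading one. -/
theorem symb_ann_mul {d : ℕ} (j : Fin n) {x : Weyl n} (hx : x ∈ filt n d) :
    symb n (d + 1) (ann j * x) = X (Sum.inr j) * symb n d x := by
  induction hx using Submodule.span_induction with
  | mem x hx =>
    obtain ⟨γ, hγ, rfl⟩ := hx
    have h2 : γ.size ≤ d := hγ
    have h3 : (γ.1 j : ℂ) • symb n (d + 1) (nmon (γ.1 - Pi.single j 1, γ.2)) = 0 := by
      by_cases h : γ.1 j = 0
      · simp [h]
      · have h1 := size_sub_left h
        rw [symb_nmon, if_neg (by omega), smul_zero]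
    rw [ann_mul_nmon, map_add, map_smul, h3, add_zero, symb_nmon, symb_nmon, size_add_right]
    by_cases h : γ.size = d
    · rw [if_pos (by omega), if_pos h, X_inr_mul_mono]
    · rw [if_neg (by omega), if_neg h, mul_zero]
  | zero => simp
  | add x y _ _ hx hy => rw [mul_add, map_add, hx, hy, map_add, mul_add]
  | smul c x _ hx => rw [mul_smul_comm, map_smul, hx, map_smul, mul_smul_comm]

theorem symb_lie_ann (d : ℕ) (j : Fin n) (x : Weyl n) :
    symb n d ⁅ann j, x⁆ = pderiv (Sum.inl j) (symb n (d + 1) x) := by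
  induction nmon_span x using Submodule.span_induction with
  | mem x hx =>
    obtain ⟨γ, rfl⟩ := hx
    rw [lie_ann_nmon, map_smul, symb_nmon, symb_nmon]
    by_cases h : γ.1 j = 0
    · split_ifs <;> simp [h, pderiv_inl_mono]
    · have h1 := size_sub_left h
      by_cases h2 : γ.size = d + 1
      · rw [if_pos (by omega), if_pos h2, pderiv_inl_mono]
      · rw [if_neg (by omega), if_neg h2, map_zero, smul_zero]
  | zero => simp
  | add x y _ _ hx hy => rw [lie_add, map_add, hx, hy, map_add, map_add]
  | smul c x _ hx =>
    rw [Ring.lie_def, mul_smul_comm, smul_mul_assoc, ← smul_sub, ← Ring.lie_def, map_smul, hx,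
      map_smul, Derivation.map_smul]

theorem symb_lie_cre (d : ℕ) (j : Fin n) (x : Weyl n) :
    symb n d ⁅cre j, x⁆ = -pderiv (Sum.inr j) (symb n (d + 1) x) := by
  induction nmon_span x using Submodule.span_induction with
  | mem x hx =>
    obtain ⟨γ, rfl⟩ := hx
    rw [lie_cre_nmon, map_neg, map_smul, symb_nmon, symb_nmon]
    by_cases h : γ.2 j = 0
    · split_ifs <;> simp [h, pderiv_inr_mono]
    · have h1 := size_sub_right h
      by_cases h2 : γ.size = d + 1
      · rw [if_pos (by omega), if_pos h2, pderiv_inr_mono]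
      · rw [if_neg (by omega), if_neg h2, map_zero, smul_zero]
  | zero => simp
  | add x y _ _ hx hy => rw [lie_add, map_add, hx, hy, map_add, map_add, neg_add]
  | smul c x _ hx =>
    rw [Ring.lie_def, mul_smul_comm, smul_mul_assoc, ← smul_sub, ← Ring.lie_def, map_smul, hx,
      map_smul, Derivation.map_smul, smul_neg]

/-- Each step of the filtration is generated from the previous one by left multiplication with
`1`, `a_j†` and `a_j`. -/
theorem filt_succ_induction {d : ℕ} {Q : Weyl n → Prop}
    (hadd : ∀ x y, Q x → Q y → Q (x + y)) (hsmul : ∀ (c : ℂ) x, Q x → Q (c • x))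
    (hle : ∀ x ∈ filt n d, Q x) (hcre : ∀ j, ∀ x ∈ filt n d, Q (cre j * x))
    (hann : ∀ j, ∀ x ∈ filt n d, Q (ann j * x)) {x : Weyl n} (hx : x ∈ filt n (d + 1)) :
    Q x := by
  induction hx using Submodule.span_induction with
  | mem x hx =>
    obtain ⟨⟨α, β⟩, hγ, rfl⟩ := hx
    have hs : MIdx.size (α, β) ≤ d + 1 := hγ
    by_cases hα : ∃ j, α j ≠ 0
    · obtain ⟨j, hj⟩ := hα
      have h1 := size_sub_left (γ := (α, β)) hj
      have h2 := cre_mul_nmon j (α - Pi.single j 1, β)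
      simp only [sub_single_add_single hj] at h2
      rw [← h2]
      exact hcre j _ (nmon_mem_filt (by simp only at h1; omega))
    by_cases hβ : ∃ j, β j ≠ 0
    · obtain ⟨j, hj⟩ := hβ
      have h1 := size_sub_right (γ := (α, β)) hj
      have h2 := ann_mul_nmon j (α, β - Pi.single j 1)
      push Not at hα
      simp only [sub_single_add_single hj, hα, Nat.cast_zero, zero_smul, add_zero] at h2
      rw [← h2]
      exact hann j _ (nmon_mem_filt (by simp only at h1; omega))
    push Not at hα hβ
    exact hle _ (nmon_mem_filt (by simp [MIdx.size, hα, hβ]))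
  | zero => exact hle 0 (zero_mem _)
  | add x y _ _ hx hy => exact hadd x y hx hy
  | smul c x _ hx => exact hsmul c x hx

theorem exists_eq_smul_one_of_mem_filt_zero {x : Weyl n} (hx : x ∈ filt n 0) :
    ∃ c : ℂ, x = c • (1 : Weyl n) := by
  induction hx using Submodule.span_induction with
  | mem x hx =>
    obtain ⟨γ, hγ, rfl⟩ := hx
    have hs : γ.size = 0 := Nat.le_zero.mp hγ
    simp only [MIdx.size, Nat.add_eq_zero_iff, Finset.sum_eq_zero_iff, Finset.mem_univ,
      true_implies] at hs
    have h1 : γ.1 = 0 := funext hs.1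
    have h2 : γ.2 = 0 := funext hs.2
    exact ⟨1, by simp [nmon, h1, h2, ordProd_zero]⟩
  | zero => exact ⟨0, by simp⟩
  | add x y _ _ hx hy =>
    obtain ⟨c, rfl⟩ := hx
    obtain ⟨d, rfl⟩ := hy
    exact ⟨c + d, by rw [add_smul]⟩
  | smul c x _ hx =>
    obtain ⟨d, rfl⟩ := hx
    exact ⟨c * d, by rw [mul_smul]⟩

theorem symb_zero_one : symb n 0 (1 : Weyl n) = 1 := by
  have h : (1 : Weyl n) = nmon (0, 0) := by simp [nmon, ordProd_zero]
  have he : MIdx.exponent ((0, 0) : MIdx n) = 0 := by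
    ext (i | i) <;> simp [MIdx.exponent]
  rw [h, symb_nmon, if_pos (by simp [MIdx.size]), MIdx.mono, he]
  rfl

theorem one_mem_filt (d : ℕ) : (1 : Weyl n) ∈ filt n d := by
  have h : (1 : Weyl n) = nmon (0, 0) := by simp [nmon, ordProd_zero]
  rw [h]
  exact nmon_mem_filt (by simp [MIdx.size])

theorem symb_cre (j : Fin n) : symb n 1 (cre j) = X (Sum.inl j) := by
  have h := symb_cre_mul 0 j (1 : Weyl n)
  rwa [mul_one, symb_zero_one, mul_one] at h

theorem symb_ann (j : Fin n) : symb n 1 (ann j) = X (Sum.inr j) := by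
  have h := symb_ann_mul j (one_mem_filt 0)
  rwa [mul_one, symb_zero_one, mul_one] at h

theorem mul_mem_filt_and_symb_mul {d e : ℕ} {x y : Weyl n} (hx : x ∈ filt n d)
    (hy : y ∈ filt n e) :
    x * y ∈ filt n (d + e) ∧ symb n (d + e) (x * y) = symb n d x * symb n e y := by
  induction d generalizing x with
  | zero =>
    obtain ⟨c, rfl⟩ := exists_eq_smul_one_of_mem_filt_zero hx
    rw [smul_mul_assoc, one_mul, zero_add]
    refine ⟨Submodule.smul_mem _ c hy, ?_⟩
    rw [map_smul, map_smul, symb_zero_one, smul_mul_assoc, one_mul]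
  | succ d ih =>
    have hde : d + 1 + e = (d + e) + 1 := by omega
    rw [hde]
    refine filt_succ_induction (Q := fun x => x * y ∈ filt n (d + e + 1) ∧
      symb n (d + e + 1) (x * y) = symb n (d + 1) x * symb n e y)
      (fun x x' hx hx' => ?_) (fun c x hx => ?_) (fun x hx => ?_)
      (fun j x hx => ?_) (fun j x hx => ?_) hx <;> beta_reduce at *
    · rw [add_mul, map_add, map_add, hx.2, hx'.2, add_mul]
      exact ⟨add_mem hx.1 hx'.1, rfl⟩
    · rw [smul_mul_assoc, map_smul, map_smul, hx.2, smul_mul_assoc]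
      exact ⟨Submodule.smul_mem _ c hx.1, rfl⟩
    · refine ⟨filt_mono (Nat.le_succ _) (ih hx).1, ?_⟩
      rw [symb_eq_zero (Nat.lt_succ_self _) (ih hx).1, symb_eq_zero (Nat.lt_succ_self _) hx,
        zero_mul]
    · rw [mul_assoc]
      refine ⟨cre_mul_mem_filt j (ih hx).1, ?_⟩
      rw [symb_cre_mul, symb_cre_mul, (ih hx).2, mul_assoc]
    · rw [mul_assoc]
      refine ⟨ann_mul_mem_filt j (ih hx).1, ?_⟩
      rw [symb_ann_mul j (ih hx).1, symb_ann_mul j hx, (ih hx).2, mul_assoc]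

/-! ### The Poisson bracket of symbols -/

/-- The Poisson bracket on commutative polynomials with `{w_i, z_j} = δ_ij`. -/
def poisson (f h : MvPolynomial (Fin n ⊕ Fin n) ℂ) : MvPolynomial (Fin n ⊕ Fin n) ℂ :=
  ∑ j : Fin n, (pderiv (Sum.inr j) f * pderiv (Sum.inl j) h -
    pderiv (Sum.inl j) f * pderiv (Sum.inr j) h)

theorem poisson_add_left (f f' h : MvPolynomial (Fin n ⊕ Fin n) ℂ) :
    poisson (f + f') h = poisson f h + poisson f' h := by
  simp only [poisson, ← Finset.sum_add_distrib, map_add]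
  exact Finset.sum_congr rfl fun j _ => by ring

theorem poisson_swap (f h : MvPolynomial (Fin n ⊕ Fin n) ℂ) :
    poisson h f = -poisson f h := by
  simp only [poisson, ← Finset.sum_neg_distrib]
  exact Finset.sum_congr rfl fun j _ => by ring

theorem poisson_mul_left (f f' h : MvPolynomial (Fin n ⊕ Fin n) ℂ) :
    poisson (f * f') h = f * poisson f' h + poisson f h * f' := by
  simp only [poisson, Finset.mul_sum, Finset.sum_mul, ← Finset.sum_add_distrib,
    MvPolynomial.pderiv_mul]
  exact Finset.sum_congr rfl fun j _ => by ring

theorem poisson_C_left (c : ℂ) (h : MvPolynomial (Fin n ⊕ Fin n) ℂ) :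
    poisson (C c) h = 0 := by
  simp [poisson]

theorem poisson_self (f : MvPolynomial (Fin n ⊕ Fin n) ℂ) : poisson f f = 0 := by
  simp [poisson, mul_comm]

theorem poisson_C_mul_left (c : ℂ) (f h : MvPolynomial (Fin n ⊕ Fin n) ℂ) :
    poisson (C c * f) h = C c * poisson f h := by
  rw [poisson_mul_left, poisson_C_left, zero_mul, add_zero]

theorem poisson_add_right (f h h' : MvPolynomial (Fin n ⊕ Fin n) ℂ) :
    poisson f (h + h') = poisson f h + poisson f h' := by
  rw [poisson_swap, poisson_add_left, neg_add, ← poisson_swap, ← poisson_swap]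

theorem poisson_mul_right (f h h' : MvPolynomial (Fin n ⊕ Fin n) ℂ) :
    poisson f (h * h') = h * poisson f h' + poisson f h * h' := by
  rw [poisson_swap, poisson_mul_left, poisson_swap f h', poisson_swap f h]
  ring

theorem poisson_C_mul_right (c : ℂ) (f h : MvPolynomial (Fin n ⊕ Fin n) ℂ) :
    poisson f (C c * h) = C c * poisson f h := by
  rw [poisson_swap, poisson_C_mul_left, poisson_swap f h]
  ring

theorem poisson_X_inl (j : Fin n) (h : MvPolynomial (Fin n ⊕ Fin n) ℂ) :
    poisson (X (Sum.inl j)) h = -pderiv (Sum.inr j) h := by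
  rw [poisson, Finset.sum_eq_single j]
  · simp [MvPolynomial.pderiv_X]
  · intro i _ hi
    simp [MvPolynomial.pderiv_X, Ne.symm hi]
  · simp

theorem poisson_X_inr (j : Fin n) (h : MvPolynomial (Fin n ⊕ Fin n) ℂ) :
    poisson (X (Sum.inr j)) h = pderiv (Sum.inl j) h := by
  rw [poisson, Finset.sum_eq_single j]
  · simp [MvPolynomial.pderiv_X]
  · intro i _ hi
    simp [MvPolynomial.pderiv_X, Ne.symm hi]
  · simp

theorem lie_smul_one_left (c : ℂ) (y : Weyl n) : ⁅c • (1 : Weyl n), y⁆ = 0 := by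
  rw [Ring.lie_def, smul_mul_assoc, mul_smul_comm, one_mul, mul_one, sub_self]

theorem mul_lie_leibniz (u x y : Weyl n) : ⁅u * x, y⁆ = u * ⁅x, y⁆ + ⁅u, y⁆ * x := by
  simp only [Ring.lie_def]
  noncomm_ring

theorem smul_lie_left (c : ℂ) (x y : Weyl n) : ⁅c • x, y⁆ = c • ⁅x, y⁆ := by
  rw [Ring.lie_def, smul_mul_assoc, mul_smul_comm, ← smul_sub, ← Ring.lie_def]

/-- The commutator lowers the filtration degree by two, and its symbol is the Poisson bracket. -/
theorem lie_mem_filt_and_symb_lie {d e : ℕ} {x y : Weyl n} (hx : x ∈ filt n (d + 1))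
    (hy : y ∈ filt n (e + 1)) :
    ⁅x, y⁆ ∈ filt n (d + e) ∧
      symb n (d + e) ⁅x, y⁆ = poisson (symb n (d + 1) x) (symb n (e + 1) y) := by
  induction d generalizing x with
  | zero =>
    rw [zero_add, zero_add]
    refine filt_succ_induction (Q := fun x => ⁅x, y⁆ ∈ filt n e ∧
      symb n e ⁅x, y⁆ = poisson (symb n 1 x) (symb n (e + 1) y))
      (fun x x' hx hx' => ?_) (fun c x hx => ?_) (fun x hx => ?_)
      (fun j x hx => ?_) (fun j x hx => ?_) hx <;> beta_reduce at *
    · rw [add_lie, map_add, map_add, hx.2, hx'.2, poisson_add_left]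
      exact ⟨add_mem hx.1 hx'.1, rfl⟩
    · rw [smul_lie_left, map_smul, map_smul, hx.2, MvPolynomial.smul_eq_C_mul,
        MvPolynomial.smul_eq_C_mul, poisson_C_mul_left]
      exact ⟨Submodule.smul_mem _ c hx.1, rfl⟩
    · rw [symb_eq_zero zero_lt_one hx]
      obtain ⟨c, rfl⟩ := exists_eq_smul_one_of_mem_filt_zero hx
      rw [lie_smul_one_left]
      exact ⟨zero_mem _, by simp [poisson]⟩
    · obtain ⟨c, rfl⟩ := exists_eq_smul_one_of_mem_filt_zero hx
      rw [mul_smul_comm, mul_one, smul_lie_left, map_smul, map_smul, symb_lie_cre,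
        symb_cre, MvPolynomial.smul_eq_C_mul,
        MvPolynomial.smul_eq_C_mul, poisson_C_mul_left, poisson_X_inl]
      exact ⟨Submodule.smul_mem _ c (lie_cre_mem_filt j hy), by simp⟩
    · obtain ⟨c, rfl⟩ := exists_eq_smul_one_of_mem_filt_zero hx
      rw [mul_smul_comm, mul_one, smul_lie_left, map_smul, map_smul, symb_lie_ann,
        symb_ann, MvPolynomial.smul_eq_C_mul,
        MvPolynomial.smul_eq_C_mul, poisson_C_mul_left, poisson_X_inr]
      exact ⟨Submodule.smul_mem _ c (lie_ann_mem_filt j hy), by simp⟩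
  | succ d ih =>
    have hde : d + 1 + e = (d + e) + 1 := by omega
    have hde' : e + (d + 1) = (d + e) + 1 := by omega
    rw [hde]
    refine filt_succ_induction (Q := fun x => ⁅x, y⁆ ∈ filt n (d + e + 1) ∧
      symb n (d + e + 1) ⁅x, y⁆ = poisson (symb n (d + 1 + 1) x) (symb n (e + 1) y))
      (fun x x' hx hx' => ?_) (fun c x hx => ?_) (fun x hx => ?_)
      (fun j x hx => ?_) (fun j x hx => ?_) hx <;> beta_reduce at *
    · rw [add_lie, map_add, map_add, hx.2, hx'.2, poisson_add_left]
      exact ⟨add_mem hx.1 hx'.1, rfl⟩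
    · rw [smul_lie_left, map_smul, map_smul, hx.2, MvPolynomial.smul_eq_C_mul,
        MvPolynomial.smul_eq_C_mul, poisson_C_mul_left]
      exact ⟨Submodule.smul_mem _ c hx.1, rfl⟩
    · refine ⟨filt_mono (Nat.le_succ _) (ih hx).1, ?_⟩
      rw [symb_eq_zero (Nat.lt_succ_self _) (ih hx).1, symb_eq_zero (Nat.lt_succ_self _) hx]
      simp [poisson]
    · obtain ⟨h1, h2⟩ := mul_mem_filt_and_symb_mul (lie_cre_mem_filt j hy) hx
      rw [hde'] at h1 h2
      rw [mul_lie_leibniz]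
      refine ⟨add_mem (cre_mul_mem_filt j (ih hx).1) h1, ?_⟩
      rw [map_add, symb_cre_mul, symb_cre_mul, (ih hx).2, h2, symb_lie_cre, poisson_mul_left,
        poisson_X_inl]
    · obtain ⟨h1, h2⟩ := mul_mem_filt_and_symb_mul (lie_ann_mem_filt j hy) hx
      rw [hde'] at h1 h2
      rw [mul_lie_leibniz]
      refine ⟨add_mem (ann_mul_mem_filt j (ih hx).1) h1, ?_⟩
      rw [map_add, symb_ann_mul j (ih hx).1, symb_ann_mul j hx, (ih hx).2, h2, symb_lie_ann,
        poisson_mul_left, poisson_X_inr]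

/-! ### Polynomials in the action variables -/

/-- The substitution `N_j ↦ z_j w_j`, embedding polynomials in the action variables `N_j` into the
algebra of symbols. -/
def actionHom (n : ℕ) : MvPolynomial (Fin n) ℂ →ₐ[ℂ] MvPolynomial (Fin n ⊕ Fin n) ℂ :=
  MvPolynomial.aeval fun j => X (Sum.inl j) * X (Sum.inr j)

theorem actionHom_X (j : Fin n) :
    actionHom n (X j) = X (Sum.inl j) * X (Sum.inr j) := MvPolynomial.aeval_X _ _

theorem actionHom_C (c : ℂ) : actionHom n (C c) = C c := MvPolynomial.aeval_C _ _

theorem actionHom_injective : Function.Injective (actionHom n) := by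
  -- setting `w_j = 1` is a left inverse
  let r : MvPolynomial (Fin n ⊕ Fin n) ℂ →ₐ[ℂ] MvPolynomial (Fin n) ℂ :=
    MvPolynomial.aeval (Sum.elim X fun _ => 1)
  have h : r.comp (actionHom n) = AlgHom.id ℂ _ := by
    apply MvPolynomial.algHom_ext
    intro j
    simp [r, actionHom_X]
  exact Function.LeftInverse.injective (g := r) fun p => DFunLike.congr_fun h p

/-- An eigenvector `f` of all the `{·, z_j w_j}` is differentiated along its weight by the
polynomials in the action variables. -/
theorem poisson_actionHom {f : MvPolynomial (Fin n ⊕ Fin n) ℂ} {c : Fin n → ℂ}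
    (hf : ∀ j, poisson f (X (Sum.inl j) * X (Sum.inr j)) = C (c j) * f)
    (p : MvPolynomial (Fin n) ℂ) :
    poisson f (actionHom n p) =
      actionHom n (MvPolynomial.mkDerivation ℂ (fun j => C (c j)) p) * f := by
  induction p using MvPolynomial.induction_on with
  | C a =>
    rw [actionHom_C, poisson_swap, poisson_C_left, MvPolynomial.derivation_C]
    simp
  | add p q hp hq => rw [map_add, poisson_add_right, hp, hq, map_add, map_add, add_mul]
  | mul_X p j hp =>
    rw [map_mul, poisson_mul_right, actionHom_X, hp, hf, Derivation.leibniz,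
      MvPolynomial.mkDerivation_X, map_add, smul_eq_mul, smul_eq_mul, map_mul, map_mul,
      actionHom_X, actionHom_C]
    ring

theorem poisson_actionHom_actionHom (p q : MvPolynomial (Fin n) ℂ) :
    poisson (actionHom n p) (actionHom n q) = 0 := by
  have h0 : (MvPolynomial.mkDerivation ℂ fun _ : Fin n => C (0 : ℂ)) =
      (0 : Derivation ℂ (MvPolynomial (Fin n) ℂ) (MvPolynomial (Fin n) ℂ)) := by
    apply MvPolynomial.derivation_ext
    intro j
    simp [MvPolynomial.mkDerivation_X]
  have h1 : ∀ j, poisson (actionHom n p) (X (Sum.inl j) * X (Sum.inr j)) = 0 := by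
    intro j
    rw [poisson_swap, poisson_actionHom (c := fun _ => 0), h0]
    · simp
    · intro i
      rw [poisson_mul_left, poisson_mul_right, poisson_mul_right, poisson_X_inl, poisson_X_inl,
        poisson_X_inr, poisson_X_inr]
      by_cases hij : i = j
      · subst hij
        simp [MvPolynomial.pderiv_X]
      · simp [MvPolynomial.pderiv_X, hij]
  rw [poisson_actionHom (c := fun _ => 0), h0]
  · simp
  · intro j
    rw [h1, map_zero, zero_mul]

/-- The derivation `∑_j (β_j - α_j) ∂/∂N_j` of the polynomials in the action variables. -/
def weightDeriv (γ : MIdx n) :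
    Derivation ℂ (MvPolynomial (Fin n) ℂ) (MvPolynomial (Fin n) ℂ) :=
  MvPolynomial.mkDerivation ℂ fun j => C ((γ.2 j : ℂ) - γ.1 j)

theorem X_inl_mul_pderiv_mono (j : Fin n) (γ : MIdx n) :
    X (Sum.inl j) * pderiv (Sum.inl j) γ.mono = C (γ.1 j : ℂ) * γ.mono := by
  rw [pderiv_inl_mono, mul_smul_comm, X_inl_mul_mono, MvPolynomial.smul_eq_C_mul]
  by_cases h : γ.1 j = 0
  · simp [h]
  · rw [sub_single_add_single h]

theorem X_inr_mul_pderiv_mono (j : Fin n) (γ : MIdx n) :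
    X (Sum.inr j) * pderiv (Sum.inr j) γ.mono = C (γ.2 j : ℂ) * γ.mono := by
  rw [pderiv_inr_mono, mul_smul_comm, X_inr_mul_mono, MvPolynomial.smul_eq_C_mul]
  by_cases h : γ.2 j = 0
  · simp [h]
  · rw [sub_single_add_single h]

theorem poisson_mono_action (j : Fin n) (γ : MIdx n) :
    poisson γ.mono (X (Sum.inl j) * X (Sum.inr j)) =
      C ((γ.2 j : ℂ) - γ.1 j) * γ.mono := by
  rw [poisson_swap, poisson_mul_left, poisson_X_inl, poisson_X_inr, X_inl_mul_pderiv_mono, map_sub]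
  linear_combination X_inr_mul_pderiv_mono j γ

theorem poisson_actionHom_mul_mono (γ : MIdx n) (p q : MvPolynomial (Fin n) ℂ) :
    poisson (actionHom n p * γ.mono) (actionHom n q) =
      actionHom n (weightDeriv γ q) * (actionHom n p * γ.mono) := by
  rw [poisson_mul_left, poisson_actionHom_actionHom,
    poisson_actionHom fun j => poisson_mono_action j γ, weightDeriv]
  ring

theorem weightDeriv_swap (γ : MIdx n) : weightDeriv γ.swap = -weightDeriv γ := by
  apply MvPolynomial.derivation_ext
  intro j
  simp [weightDeriv, MvPolynomial.mkDerivation_X]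

theorem mono_ne_zero (γ : MIdx n) : γ.mono ≠ 0 := by
  rw [MIdx.mono, Ne, MvPolynomial.monomial_eq_zero]
  exact one_ne_zero

/-- The monomial `N^(α+β)`. -/
def MIdx.action (γ : MIdx n) : MvPolynomial (Fin n) ℂ := ∏ j, X j ^ (γ.1 j + γ.2 j)

theorem mono_mul_mono_swap (γ : MIdx n) :
    γ.mono * MIdx.mono γ.swap = actionHom n γ.action := by
  have h : ∀ δ : MIdx n, δ.mono =
      (∏ j, X (Sum.inl j) ^ δ.1 j) * ∏ j, X (Sum.inr j) ^ δ.2 j := by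
    intro δ
    rw [MIdx.mono, MvPolynomial.monomial_eq, MvPolynomial.C_1, one_mul,
      Finsupp.prod_fintype _ _ (by simp), Fintype.prod_sum_type]
    simp [MIdx.exponent]
  rw [h, h, MIdx.action, map_prod, ← Finset.prod_mul_distrib, ← Finset.prod_mul_distrib,
    ← Finset.prod_mul_distrib]
  refine Finset.prod_congr rfl fun j _ => ?_
  rw [map_pow, actionHom_X, Prod.fst_swap, Prod.snd_swap]
  ring

/-- With `x = p z^α w^β` and `x' = p z^β w^α`, the bracket `{x, x'}` is found from
`{x, x x'} = x {x, x'}`, because `x x'` is a polynomial in the action variables. -/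
theorem poisson_mono_mono_swap (γ : MIdx n) {p : MvPolynomial (Fin n) ℂ} (hp : p ≠ 0) :
    poisson (actionHom n p * γ.mono) (actionHom n p * MIdx.mono γ.swap) =
      actionHom n (weightDeriv γ (p ^ 2 * γ.action)) := by
  have hx : actionHom n p * γ.mono ≠ 0 :=
    mul_ne_zero ((map_ne_zero_iff _ actionHom_injective).mpr hp) (mono_ne_zero γ)
  have h1 := poisson_actionHom_mul_mono γ p (p ^ 2 * γ.action)
  have h2 : actionHom n (p ^ 2 * γ.action) =
      (actionHom n p * γ.mono) * (actionHom n p * MIdx.mono γ.swap) := by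
    rw [map_mul, map_pow, ← mono_mul_mono_swap]
    ring
  rw [h2, poisson_mul_right, poisson_self, zero_mul, add_zero, mul_comm] at h1
  exact mul_right_cancel₀ hx h1

/-! ### Nonvanishing of the second derivative along the weight -/

/-- Translation `N_j ↦ N_j + (β_j - α_j) T` along the weight, with values in polynomials in `T`. -/
def shiftHom (γ : MIdx n) : MvPolynomial (Fin n) ℂ →ₐ[ℂ] Polynomial (MvPolynomial (Fin n) ℂ) :=
  MvPolynomial.aeval fun j =>
    Polynomial.C (C ((γ.2 j : ℂ) - γ.1 j)) * Polynomial.X + Polynomial.C (X j)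

theorem shiftHom_X (γ : MIdx n) (j : Fin n) :
    shiftHom γ (X j) =
      Polynomial.C (C ((γ.2 j : ℂ) - γ.1 j)) * Polynomial.X + Polynomial.C (X j) :=
  MvPolynomial.aeval_X _ _

theorem shiftHom_C (γ : MIdx n) (c : ℂ) : shiftHom γ (C c) = Polynomial.C (C c) :=
  MvPolynomial.aeval_C _ _

theorem shiftHom_weightDeriv (γ : MIdx n) (p : MvPolynomial (Fin n) ℂ) :
    shiftHom γ (weightDeriv γ p) = Polynomial.derivative (shiftHom γ p) := by
  induction p using MvPolynomial.induction_on with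
  | C a => rw [shiftHom_C, MvPolynomial.derivation_C, map_zero,
      Polynomial.derivative_C]
  | add p q hp hq => rw [map_add, map_add, hp, hq, map_add, map_add]
  | mul_X p j hp =>
    have hX : weightDeriv γ (X j) = C ((γ.2 j : ℂ) - γ.1 j) := by
      rw [weightDeriv, MvPolynomial.mkDerivation_X]
    rw [Derivation.leibniz, hX, smul_eq_mul, smul_eq_mul, map_add, map_mul, map_mul, hp, map_mul,
      Polynomial.derivative_mul, shiftHom_X, shiftHom_C]
    simp only [Polynomial.derivative_add, Polynomial.derivative_mul, Polynomial.derivative_C,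
      Polynomial.derivative_X]
    ring

theorem shiftHom_injective (γ : MIdx n) : Function.Injective (shiftHom γ) := by
  -- setting `T = 0` is a left inverse
  have h : ∀ p, (shiftHom γ p).eval 0 = p := by
    intro p
    induction p using MvPolynomial.induction_on with
    | C a => rw [shiftHom_C, Polynomial.eval_C]
    | add p q hp hq => rw [map_add, Polynomial.eval_add, hp, hq]
    | mul_X p j hp => rw [map_mul, Polynomial.eval_mul, hp, shiftHom_X]; simp
  exact Function.LeftInverse.injective h

theorem natDegree_shiftHom_action (γ : MIdx n) :
    (shiftHom γ γ.action).natDegree =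
      ∑ j ∈ Finset.univ.filter (fun j => γ.1 j ≠ γ.2 j), (γ.1 j + γ.2 j) := by
  rw [MIdx.action, map_prod, Polynomial.natDegree_prod, Finset.sum_filter]
  · refine Finset.sum_congr rfl fun j _ => ?_
    rw [map_pow, Polynomial.natDegree_pow, shiftHom_X]
    by_cases h : γ.1 j = γ.2 j
    · simp [h]
    · have h' : (C ((γ.2 j : ℂ) - γ.1 j) : MvPolynomial (Fin n) ℂ) ≠ 0 := by
        rw [Ne, MvPolynomial.C_eq_zero, sub_eq_zero]
        exact_mod_cast Ne.symm h
      rw [Polynomial.natDegree_linear h', mul_one, if_pos h]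
  · intro j _
    exact (map_ne_zero_iff _ (shiftHom_injective γ)).mpr (pow_ne_zero _ (MvPolynomial.X_ne_zero j))

/-- Along the line through `N` in the direction of the weight, `p² N^(α+β)` has degree at least
that of `N^(α+β)`. Hence it is not killed by the second derivative if the latter is at least two. -/
theorem weightDeriv_weightDeriv_ne_zero {γ : MIdx n}
    (hγ : 2 ≤ ∑ j ∈ Finset.univ.filter (fun j => γ.1 j ≠ γ.2 j), (γ.1 j + γ.2 j))
    {p : MvPolynomial (Fin n) ℂ} (hp : p ≠ 0) :
    weightDeriv γ (weightDeriv γ (p ^ 2 * γ.action)) ≠ 0 := by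
  intro h
  have h1 := congrArg (shiftHom γ) h
  rw [shiftHom_weightDeriv, shiftHom_weightDeriv, map_zero] at h1
  have h2 := Polynomial.derivative_eq_zero.mp h1
  rw [Polynomial.natDegree_derivative, map_mul, Polynomial.natDegree_mul,
    natDegree_shiftHom_action] at h2
  · omega
  · exact (map_ne_zero_iff _ (shiftHom_injective γ)).mpr (pow_ne_zero _ hp)
  · refine (map_ne_zero_iff _ (shiftHom_injective γ)).mpr ?_
    exact Finset.prod_ne_zero_iff.mpr fun j _ => pow_ne_zero _ (MvPolynomial.X_ne_zero j)

/-! ### Symbols along the commutator chain -/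

theorem size_swap (γ : MIdx n) : MIdx.size γ.swap = γ.size := add_comm _ _

/-- One step of the chain on symbols `p (m' + ε m)` and `c p (m' - ε m)`, where `m = z^α w^β`
and `m' = z^β w^α`: the shape is preserved, with `p` multiplied by a scalar multiple of the second
derivative of `p² N^(α+β)` along the weight. -/
theorem poisson_chain_step (γ : MIdx n) {p : MvPolynomial (Fin n) ℂ} (hp : p ≠ 0) (ε c : ℂ) :
    let q := C (-2 * c * ε) * (p * weightDeriv γ (weightDeriv γ (p ^ 2 * γ.action)))
    let u := actionHom n p * (MIdx.mono γ.swap + C ε * γ.mono)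
    let v := C c * (actionHom n p * (MIdx.mono γ.swap - C ε * γ.mono))
    poisson u (poisson u v) = actionHom n q * (MIdx.mono γ.swap + C (-ε) * γ.mono) ∧
    poisson v (poisson u v) =
      C c * (actionHom n q * (MIdx.mono γ.swap - C (-ε) * γ.mono)) := by
  intro q u v
  set R := weightDeriv γ (p ^ 2 * γ.action) with hR
  set x := actionHom n p * γ.mono with hx
  set x' := actionHom n p * MIdx.mono γ.swap with hx'
  have hu : u = x' + C ε * x := by simp only [u, hx, hx']; ring
  have hv : v = C c * (x' + C (-ε) * x) := by simp only [v, hx, hx', map_neg]; ring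
  have hxx : poisson x x' = actionHom n R := poisson_mono_mono_swap γ hp
  have hxx' : poisson x' x = -actionHom n R := by rw [poisson_swap, hxx]
  have huv : poisson u v = C (2 * c * ε) * actionHom n R := by
    rw [hu, hv, poisson_C_mul_right, poisson_add_left, poisson_add_right, poisson_add_right,
      poisson_C_mul_left, poisson_C_mul_left, poisson_C_mul_right, poisson_C_mul_right,
      poisson_self, poisson_self, hxx, hxx']
    simp only [map_mul, map_neg, map_ofNat]
    ring
  have hxR : poisson x (actionHom n R) = actionHom n (weightDeriv γ R) * x :=
    poisson_actionHom_mul_mono γ p R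
  have hxR' : poisson x' (actionHom n R) = -(actionHom n (weightDeriv γ R) * x') := by
    rw [hx', poisson_actionHom_mul_mono γ.swap p R, weightDeriv_swap, Derivation.neg_apply, map_neg,
      neg_mul]
  have hq : actionHom n q = C (-2 * c * ε) * (actionHom n p * actionHom n (weightDeriv γ R)) := by
    simp only [q, map_mul, actionHom_C, hR]
  rw [huv, hq]
  constructor
  · rw [hu, poisson_C_mul_right, poisson_add_left, poisson_C_mul_left, hxR, hxR', hx, hx']
    simp only [map_mul, map_neg, map_ofNat]
    ring
  · rw [hv, poisson_C_mul_right, poisson_C_mul_left, poisson_add_left, poisson_C_mul_left, hxR,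
      hxR', hx, hx']
    simp only [map_mul, map_neg, map_ofNat]
    ring

theorem g_mem_filt (σ : Sgn) (γ : MIdx n) : g σ γ ∈ filt n γ.size := by
  have h1 : nmon γ ∈ filt n γ.size := nmon_mem_filt le_rfl
  have h2 : nmon γ.swap ∈ filt n γ.size := nmon_mem_filt (size_swap γ).le
  cases σ with
  | plus => rw [g, star_nmon]; exact Submodule.smul_mem _ _ (add_mem h2 h1)
  | minus => rw [g, star_nmon]; exact sub_mem h2 h1

theorem chainII_mem_filt_and_symb {γ : MIdx n} (h3 : 3 ≤ γ.size)
    (hγ : 2 ≤ ∑ j ∈ Finset.univ.filter (fun j => γ.1 j ≠ γ.2 j), (γ.1 j + γ.2 j)) (ℓ : ℕ) :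
    (∀ σ, chainII γ ℓ σ ∈ filt n (3 ^ ℓ * (γ.size - 2) + 2)) ∧
    ∃ (p : MvPolynomial (Fin n) ℂ) (ε c : ℂ), p ≠ 0 ∧ ε ≠ 0 ∧ c ≠ 0 ∧
      symb n (3 ^ ℓ * (γ.size - 2) + 2) (chainII γ ℓ Sgn.plus) =
        actionHom n p * (MIdx.mono γ.swap + C ε * γ.mono) ∧
      symb n (3 ^ ℓ * (γ.size - 2) + 2) (chainII γ ℓ Sgn.minus) =
        C c * (actionHom n p * (MIdx.mono γ.swap - C ε * γ.mono)) := by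
  induction ℓ with
  | zero =>
    have hd : 3 ^ 0 * (γ.size - 2) + 2 = γ.size := by omega
    rw [hd]
    have hI : (C (-I) * C I : MvPolynomial (Fin n ⊕ Fin n) ℂ) = 1 := by
      rw [← map_mul, neg_mul, I_mul_I, neg_neg, map_one]
    refine ⟨fun σ => g_mem_filt σ γ, C I, 1, -I, ?_, one_ne_zero, neg_ne_zero.mpr I_ne_zero,
      ?_, ?_⟩
    · rw [Ne, MvPolynomial.C_eq_zero]
      exact I_ne_zero
    · rw [chainII, g, star_nmon, map_smul, map_add, symb_nmon, symb_nmon, if_pos rfl,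
        if_pos (size_swap γ), actionHom_C, map_one, one_mul, MvPolynomial.smul_eq_C_mul]
    · rw [chainII, g, star_nmon, map_sub, symb_nmon, symb_nmon, if_pos rfl,
        if_pos (size_swap γ), actionHom_C, map_one, one_mul, ← mul_assoc, hI, one_mul]
  | succ ℓ ih =>
    obtain ⟨hm, p, ε, c, hp, hε, hc, hplus, hminus⟩ := ih
    obtain ⟨e, he⟩ : ∃ e, 3 ^ ℓ * (γ.size - 2) = e + 1 := by
      refine Nat.exists_eq_succ_of_ne_zero ?_
      have : 0 < 3 ^ ℓ := by positivity
      exact (Nat.mul_pos this (by omega)).ne'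
    have hd : 3 ^ (ℓ + 1) * (γ.size - 2) + 2 = (e + 2) + (e + 2 + (e + 1)) := by
      rw [pow_succ, mul_comm _ 3, mul_assoc, he]
      omega
    rw [he] at hm hplus hminus
    rw [hd]
    have hbr := lie_mem_filt_and_symb_lie (hm Sgn.plus) (hm Sgn.minus)
    have hbr' := fun σ => lie_mem_filt_and_symb_lie (hm σ) hbr.1
    have hstep := poisson_chain_step γ hp ε c
    refine ⟨fun σ => (hbr' σ).1,
      C (-2 * c * ε) * (p * weightDeriv γ (weightDeriv γ (p ^ 2 * γ.action))), -ε, c, ?_,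
      neg_ne_zero.mpr hε, hc, ?_, ?_⟩
    · refine mul_ne_zero ?_ (mul_ne_zero hp (weightDeriv_weightDeriv_ne_zero hγ hp))
      rw [Ne, MvPolynomial.C_eq_zero]
      simp [hc, hε]
    · rw [chainII]
      refine (hbr' Sgn.plus).2.trans ?_
      rw [hplus]
      erw [hbr.2]
      rw [hplus, hminus]
      exact hstep.1
    · rw [chainII]
      refine (hbr' Sgn.minus).2.trans ?_
      rw [hminus]
      erw [hbr.2]
      rw [hplus, hminus]
      exact hstep.2

theorem mono_swap_add_ne_zero {γ : MIdx n} (hγ : γ.1 ≠ γ.2) (ε : ℂ) :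
    MIdx.mono γ.swap + C ε * γ.mono ≠ 0 := by
  intro h
  have hne : γ.exponent ≠ MIdx.exponent γ.swap := fun h' =>
    hγ (congrArg Prod.fst (MIdx.exponent_injective h'))
  have h1 := congrArg (MvPolynomial.coeff (MIdx.exponent γ.swap)) h
  simp [MIdx.mono, MvPolynomial.coeff_monomial, hne, MvPolynomial.coeff_C_mul] at h1

theorem deg_chainII {γ : MIdx n} (h3 : 3 ≤ γ.size)
    (hγ : 2 ≤ ∑ j ∈ Finset.univ.filter (fun j => γ.1 j ≠ γ.2 j), (γ.1 j + γ.2 j))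
    (ℓ : ℕ) (σ : Sgn) :
    deg (chainII γ ℓ σ) = ((3 ^ ℓ * (γ.size - 2) + 2 : ℕ) : WithBot ℕ) := by
  obtain ⟨hm, p, ε, c, hp, hε, hc, hplus, hminus⟩ := chainII_mem_filt_and_symb h3 hγ ℓ
  have hne : γ.1 ≠ γ.2 := by
    intro h
    simp [h] at hγ
  have hp' : actionHom n p ≠ 0 := (map_ne_zero_iff _ actionHom_injective).mpr hp
  refine deg_eq_of_symb_ne_zero (hm σ) ?_
  cases σ with
  | plus => rw [hplus]; exact mul_ne_zero hp' (mono_swap_add_ne_zero hne ε)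
  | minus =>
    rw [hminus, sub_eq_add_neg, ← neg_mul, ← map_neg]
    refine mul_ne_zero ?_ (mul_ne_zero hp' (mono_swap_add_ne_zero hne (-ε)))
    rwa [Ne, MvPolynomial.C_eq_zero]

/-! ### Basis elements orthogonal to the core -/

theorem eq_zero_of_scalarProd_self {x : Weyl n} (h : scalarProd x x = 0) : x = 0 := by
  rw [scalarProd, Finsupp.sum, Complex.re_sum, Finset.sum_eq_zero_iff_of_nonneg] at h
  · apply (nbasis n).repr.injective
    rw [map_zero]
    ext γ
    by_contra hγ
    have h1 := h γ (Finsupp.mem_support_iff.mpr hγ)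
    rw [← starRingEnd_apply, ← Complex.normSq_eq_conj_mul_self, Complex.ofReal_re,
      Complex.normSq_eq_zero] at h1
    exact hγ h1
  · intro γ _
    rw [← starRingEnd_apply, ← Complex.normSq_eq_conj_mul_self, Complex.ofReal_re]
    exact Complex.normSq_nonneg _

theorem g_ne_zero {σ : Sgn} {γ : MIdx n} (h : σ = Sgn.minus → γ.1 ≠ γ.2) : g σ γ ≠ 0 := by
  intro h0
  have hr : ∀ δ : MIdx n, (nbasis n).repr (nmon δ) = Finsupp.single δ 1 := fun δ => by
    rw [← coe_nbasis, Module.Basis.repr_self]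
  have h1 := congrArg (fun x => (nbasis n).repr x γ) h0
  cases σ with
  | plus =>
    simp only [g, star_nmon, map_smul, map_add, hr, map_zero, Finsupp.smul_apply,
      Finsupp.add_apply, Finsupp.single_apply, Finsupp.coe_zero, Pi.zero_apply, smul_eq_mul,
      if_true] at h1
    split_ifs at h1 <;> norm_num at h1
  | minus =>
    have hne : γ.swap ≠ γ := fun h' => h rfl (congrArg Prod.snd h')
    simp [g, star_nmon, map_sub, hr, hne] at h1

theorem g_notMem_core {σ : Sgn} {γ : MIdx n} (h : σ = Sgn.minus → γ.1 ≠ γ.2)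
    (hperp : g σ γ ∈ perp n) : g σ γ ∉ core n := fun hc =>
  g_ne_zero h (eq_zero_of_scalarProd_self (hperp.2 _ hc))

theorem ordProd_single (x : Fin n → Weyl n) (hx : ∀ i j, x i * x j = x j * x i) (k : Fin n) :
    ordProd x (Pi.single k 1) = x k := by
  have h := mul_ordProd x hx 0 k
  rw [ordProd_zero, mul_one, zero_add] at h
  exact h.symm

theorem size_of_fst_eq_snd {γ : MIdx n} (h : γ.1 = γ.2) : γ.size = 2 * ∑ j, γ.1 j := by
  rw [MIdx.size, ← h]
  ring

/-- The multi-indices with `α = β` label elements of the core, up to `g_-^γ = 0`. -/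
theorem g_mem_core_of_fst_eq_snd {γ : MIdx n} (h : γ.1 = γ.2) : g Sgn.plus γ ∈ core n := by
  have hs := size_of_fst_eq_snd h
  have hg : g Sgn.plus γ = (2 * I : ℂ) • nmon γ := by
    have hsw : γ.swap = γ := Prod.ext h.symm h
    rw [g, star_nmon, hsw, ← two_smul ℂ, smul_smul, mul_comm]
  by_cases h4 : 4 ≤ γ.size
  · exact (le_sup_right.trans le_sup_left : spaceEq n ≤ core n)
      (Submodule.subset_span ⟨_, γ, ⟨h, h4⟩, rfl⟩)
  refine (le_sup_left.trans (le_sup_left.trans (le_sup_left.trans le_sup_left)) :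
    space0 n ≤ core n) (Submodule.subset_span ?_)
  obtain ⟨α, β⟩ := γ
  obtain rfl : α = β := h
  simp only at hs
  by_cases h0 : ∃ k, α k ≠ 0
  · obtain ⟨k, hk⟩ := h0
    have hk' : α = Pi.single k 1 := by
      have hsum := Finset.add_sum_erase Finset.univ α (Finset.mem_univ k)
      have hz : ∑ j ∈ Finset.univ.erase k, α j = 0 := by omega
      funext j
      by_cases hj : j = k
      · subst hj
        rw [Pi.single_eq_same]
        omega
      · rw [Pi.single_eq_of_ne hj]
        exact Finset.sum_eq_zero_iff.mp hz j (Finset.mem_erase.mpr ⟨hj, Finset.mem_univ j⟩)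
    refine Or.inr ⟨k, ?_⟩
    rw [hg, nmon, hk', ordProd_single _ cre_comm, ordProd_single _ ann_comm]
  · push Not at h0
    obtain rfl : α = 0 := funext h0
    left
    rw [Set.mem_singleton_iff, hg, nmon, ordProd_zero, ordProd_zero, mul_one]

theorem size_and_sum_of_mem_perp {σ : Sgn} {γ : MIdx n} (h : σ = Sgn.minus → γ.1 ≠ γ.2)
    (hperp : g σ γ ∈ perp n) :
    3 ≤ γ.size ∧ 2 ≤ ∑ j ∈ Finset.univ.filter (fun j => γ.1 j ≠ γ.2 j), (γ.1 j + γ.2 j) := by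
  have hcore := g_notMem_core h hperp
  have hne : γ.1 ≠ γ.2 := by
    intro he
    cases σ with
    | plus => exact hcore (g_mem_core_of_fst_eq_snd he)
    | minus => exact h rfl he
  obtain ⟨k, hk⟩ := Function.ne_iff.mp hne
  set S := Finset.univ.filter (fun j => γ.1 j ≠ γ.2 j) with hS
  have hkS : k ∈ S := by simp [hS, hk]
  have hsize : γ.size = ∑ j, (γ.1 j + γ.2 j) := by rw [MIdx.size, Finset.sum_add_distrib]
  have hle : ∑ j ∈ S, (γ.1 j + γ.2 j) ≤ γ.size := by
    rw [hsize]
    exact Finset.sum_le_sum_of_subset (Finset.filter_subset _ _)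
  have hcard : S.card ≤ ∑ j ∈ S, (γ.1 j + γ.2 j) := by
    rw [Finset.card_eq_sum_ones]
    refine Finset.sum_le_sum fun j hj => ?_
    have : γ.1 j ≠ γ.2 j := (Finset.mem_filter.mp hj).2
    omega
  have hpos : 1 ≤ S.card := Finset.card_pos.mpr ⟨k, hkS⟩
  have h3 : 3 ≤ γ.size := by
    by_contra hlt
    have hcases : γ.size = 1 ∨ γ.size = 2 := by omega
    have hcard12 : S.card = 1 ∨ S.card = 2 := by omega
    rcases hcases with h1 | h2
    · exact hcore ((le_sup_right.trans (le_sup_left.trans (le_sup_left.trans le_sup_left)) :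
        space1 n ≤ core n) (Submodule.subset_span ⟨σ, γ, h1, rfl⟩))
    · exact hcore ((le_sup_right.trans (le_sup_left.trans le_sup_left) : space2 n ≤ core n)
        (Submodule.subset_span ⟨σ, γ, ⟨h2, hcard12⟩, rfl⟩))
  refine ⟨h3, ?_⟩
  by_contra hlt
  have hS1 : S = {k} := by
    obtain ⟨i, hi⟩ := Finset.card_eq_one.mp (show S.card = 1 by omega)
    rw [hi, Finset.mem_singleton] at hkS
    rw [hi, hkS]
  have hsum : γ.1 k + γ.2 k = 1 := by
    rw [hS1, Finset.sum_singleton] at hlt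
    omega
  refine hcore ((le_sup_right : spaceOm n ≤ core n)
    (Submodule.subset_span ⟨σ, γ, ⟨h3, k, ⟨hsum, fun j hj => ?_⟩, fun i hi => ?_⟩, rfl⟩))
  · by_contra hjne
    have : j ∈ S := by simp [hS, hjne]
    rw [hS1, Finset.mem_singleton] at this
    exact hj this
  · by_contra hik
    exact hk (hi.2 k (Ne.symm hik))

end BosonicWeyl

end

theorem mainTheorem5 (n : ℕ) (γ : BosonicWeyl.MIdx n) (σ : BosonicWeyl.Sgn)
    (hγ : toLex γ.2 ≤ toLex γ.1)
    (hγσ : σ = BosonicWeyl.Sgn.minus → toLex γ.2 < toLex γ.1)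
    (hperp : BosonicWeyl.g σ γ ∈ BosonicWeyl.perp n) :
    3 ≤ γ.size ∧
    (∀ ℓ : ℕ,
      BosonicWeyl.deg (BosonicWeyl.chainII γ ℓ σ) =
          ((3 ^ ℓ * (γ.size - 2) + 2 : ℕ) : WithBot ℕ) ∧
        ((3 ^ ℓ + 2 : ℕ) : WithBot ℕ) ≤ BosonicWeyl.deg (BosonicWeyl.chainII γ ℓ σ)) ∧
    (∀ D : ℕ, ∃ ℓ : ℕ, (D : WithBot ℕ) < BosonicWeyl.deg (BosonicWeyl.chainII γ ℓ σ)) := by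
  have hne : σ = BosonicWeyl.Sgn.minus → γ.1 ≠ γ.2 := fun hσ h =>
    (hγσ hσ).ne (congrArg toLex h.symm)
  obtain ⟨h3, hsum⟩ := BosonicWeyl.size_and_sum_of_mem_perp hne hperp
  have hle : ∀ ℓ : ℕ, 3 ^ ℓ + 2 ≤ 3 ^ ℓ * (γ.size - 2) + 2 := fun ℓ =>
    Nat.add_le_add_right (Nat.le_mul_of_pos_right _ (by omega)) 2
  refine ⟨h3, fun ℓ => ?_, fun D => ⟨D, ?_⟩⟩
  · rw [BosonicWeyl.deg_chainII h3 hsum]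
    exact ⟨rfl, by exact_mod_cast hle ℓ⟩
  · rw [BosonicWeyl.deg_chainII h3 hsum]
    have h1 : D < 3 ^ D := Nat.lt_pow_self (by norm_num)
    have h2 := hle D
    exact_mod_cast (by omega : D < 3 ^ D * (γ.size - 2) + 2)
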